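/- Conventions. A finitely generated group $G$ has \emph{solvable uniform membership problem} if, for some (equivalently, every) finite generating tuple $x_1,\dots,x_n$ of $G$, there is an algorithm which, given a finite list of words $w_1,\dots,w_k$ ($k\ge 0$) and a word $u$ in $x_1^{\pm1},\dots,x_n^{\pm 1}$, decides whether the element of $G$ represented by $u$ belongs to the subgroup generated by the elements represented by $w_1,\dots,w_k$. Elements of finitely generated groups are always given to, and returned by, algorithms as words in a fixed finite generating tuple. A graph $A$ is meant in the sense of Serre: it has a vertex set $VA$, an edge set $EA$, maps $o,t:EA\to VA$ and a fixed-point free involution $e\mapsto e^{-1}$ of $EA$ with $o(e)=t(e^{-1})$. A graph of groups $\mathbb A$ over $A$ assigns to each vertex $v$ a group $A_v$ and to each edge $e$ a group $A_e$ with monomorphisms $\alpha_e:A_e\to A_{o(e)}$ and $\omega_e:A_e\to A_{t(e)}$, such that $A_{e^{-1}}=A_e$, $\alpha_{e^{-1}}=\omega_e$ and $\omega_{e^{-1}}=\alpha_e$. An $\mathbb A$-path from $v$ to $v'$ is a sequence $a_0,e_1,a_1,\dots,e_k,a_k$ ($k\ge 0$) in which $e_1,\dots,e_k$ is an edge-path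 from $v$ to $v'$ and the $a_i$ are elements of the vertex groups at the successive vertices of this edge-path. The fundamental group $\pi_1(\mathbb A,v_0)$ is the group of classes of $\mathbb A$-paths from $v_0$ to $v_0$, multiplied by concatenation, under the equivalence relation generated (modulo concatenation) by $a,e,\omega_e(c),e^{-1},a'\sim a\,\alpha_e(c)\,a'$ for $e\in EA$, $c\in A_e$ and $a,a'\in A_{o(e)}$. A finite connected graph of finitely generated groups $\mathbb A$ is \emph{benign} if (1) for every edge $e$ with $v=o(e)$ there is an algorithm which, given a finite set $X\subseteq A_v$ and an element $a\in A_v$, decides whether $I=\langle X\rangle\cap a\,\alpha_e(A_e)$ is empty and, if $I\ne\emptyset$, produces an element of $I$; (2) every edge group $A_e$ is Noetherian, that is, it has no infinite strictly ascending sequence of subgroups; (3) every edge group $A_e$ has solvable uniform membership problem; (4) for every edge $e$ with $v=o(e)$ there is an algorithm which, given a finite set $X\subseteq A_v$, computes a finite generating set of $\alpha_e(A_e)\cap\langle X\rangle$. Theorem. Let $\mathbb A$ be a benign graph of groups such that each vertex group of $\mathbb A$ has solvable uniform membership problem. Let $v_0\in VA$ and $G=\pi_1(\mathbb A,v_0)$.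 Then $G$ is finitely generated and has solvable uniform membership problem: there is an algorithm which, given finitely many elements $h_1,\dots,h_k,g\in G$, decides whether $g$ belongs to the subgroup $\langle h_1,\dots,h_k\rangle\le G$. -/

import Mathlib

universe u w x y

namespace GroupAlgorithms

open scoped Pointwise

/-- Words in the letters `x₁^{±1}, …, xₙ^{±1}`; the letter `(i, true)` stands for `xᵢ` and
`(i, false)` for `xᵢ⁻¹`. -/
abbrev Word (n : ℕ) : Type := List (Fin n × Bool)

variable {G : Type*} [Group G]

/-- The element of `G` represented by a word. -/
def wordVal {n : ℕ} (x : Fin n → G) (l : Word n) : G :=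
  (l.map fun s => cond s.2 (x s.1) (x s.1)⁻¹).prod

/-- The finite tuple `x` generates the group `G`. -/
def Generates {n : ℕ} (x : Fin n → G) : Prop :=
  Subgroup.closure (Set.range x) = ⊤

/-- The subgroup of `G` generated by the elements represented by a finite list of words. -/
def spanWords {n : ℕ} (x : Fin n → G) (X : List (Word n)) : Subgroup G :=
  Subgroup.closure {g | ∃ l ∈ X, wordVal x l = g}

/-- With respect to the tuple `x`, it is decidable whether the element represented by a word `a`
lies in the subgroup generated by the elements represented by the words in a finite list `X`. -/
def MembershipDecidable {n : ℕ} (x : Fin n → G) : Prop :=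
  ComputablePred fun p : List (Word n) × Word n => wordVal x p.2 ∈ spanWords x p.1

variable (G) in
/-- `G` is finitely generated and has solvable uniform membership problem. The choice of the
finite generating tuple is immaterial, see `SolvableUniformMembership.membershipDecidable`. -/
def SolvableUniformMembership : Prop :=
  ∃ (n : ℕ) (x : Fin n → G), Generates x ∧ MembershipDecidable x

/-- `G` is finitely generated, and there is an algorithm which, given words for the elements of a
finite set `X ⊆ G` and a word for `a ∈ G`, decides whether `⟨X⟩ ∩ aH` is empty and, if it is not
empty, produces (a word for) an element of it. -/
def SolvableCosetIntersection (H : Subgroup G) : Prop :=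
  ∃ (n : ℕ) (x : Fin n → G), Generates x ∧
    ∃ f : List (Word n) × Word n → Option (Word n), Computable f ∧
      ∀ (X : List (Word n)) (a : Word n),
        (f (X, a) = none → (spanWords x X : Set G) ∩ wordVal x a • (H : Set G) = ∅) ∧
        (∀ b : Word n, f (X, a) = some b →
          wordVal x b ∈ (spanWords x X : Set G) ∩ wordVal x a • (H : Set G))

/-- `G` is finitely generated, and there is an algorithm which, given words for the elements of a
finite set `X ⊆ G`, computes a finite list of words generating the subgroup `H ∩ ⟨X⟩`. -/
def ComputableIntersection (H : Subgroup G) : Prop :=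
  ∃ (n : ℕ) (x : Fin n → G), Generates x ∧
    ∃ f : List (Word n) → List (Word n), Computable f ∧
      ∀ X : List (Word n), spanWords x (f X) = H ⊓ spanWords x X

lemma wordVal_append {n : ℕ} (x : Fin n → G) (l m : Word n) :
    wordVal x (l ++ m) = wordVal x l * wordVal x m := by
  simp [wordVal]

lemma exists_word {n : ℕ} {x : Fin n → G} (hx : Generates x) (g : G) :
    ∃ l : Word n, wordVal x l = g := by
  have hg : g ∈ Subgroup.closure (Set.range x) := by rw [hx]; trivial
  rw [← FreeGroup.range_lift_eq_closure] at hg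
  obtain ⟨z, rfl⟩ := hg
  exact ⟨z.toWord, by
    conv_rhs => rw [← FreeGroup.mk_toWord (x := z), FreeGroup.lift_mk]
    rfl⟩

/-- Solvability of the uniform membership problem does not depend on the generating tuple. -/
theorem SolvableUniformMembership.membershipDecidable (h : SolvableUniformMembership G)
    {m : ℕ} (y : Fin m → G) : MembershipDecidable y := by
  obtain ⟨n, x, hx, hdec⟩ := h
  choose c hc using fun s : Fin m × Bool => exists_word hx (cond s.2 (y s.1) (y s.1)⁻¹)
  let τ : Word m → Word n := fun l => l.flatMap c
  have hτ : ∀ l, wordVal x (τ l) = wordVal y l := by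
    intro l
    induction l with
    | nil => rfl
    | cons s l ih =>
      have : τ (s :: l) = c s ++ τ l := by simp [τ]
      rw [this, wordVal_append, ih, hc]
      simp [wordVal]
  have pτ : Primrec τ :=
    Primrec.list_flatMap Primrec.id ((Primrec.dom_finite c).comp Primrec.snd).to₂
  have pT : Primrec fun p : List (Word m) × Word m => (p.1.map τ, τ p.2) :=
    (Primrec.list_map Primrec.fst (pτ.comp Primrec.snd).to₂).pair (pτ.comp Primrec.snd)
  have hspan : ∀ X : List (Word m), spanWords x (X.map τ) = spanWords y X := by
    intro X
    unfold spanWords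
    congr 1
    ext g
    simp [hτ]
  obtain ⟨d, hd⟩ := hdec
  have hd' := hd.comp pT.to_comp
  refine ComputablePred.of_eq (p := fun p : List (Word m) × Word m =>
    wordVal x (τ p.2) ∈ spanWords x (p.1.map τ)) ⟨fun p => d (p.1.map τ, τ p.2), hd'⟩ fun p => ?_
  rw [hτ, hspan]

end GroupAlgorithms

/-- A graph in the sense of Serre: a quiver (the edges `e` with `o(e) = u` and `t(e) = v` are the
arrows `e : u ⟶ v`) together with a fixed-point free involution `e ↦ Quiver.reverse e = e⁻¹` of
the edges which exchanges initial and terminal vertices. An edge which is not a loop is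
automatically different from its inverse. -/
class SerreGraph (V : Type u) extends Quiver.{w} V, Quiver.HasInvolutiveReverse V where
  reverse_ne : ∀ {v : V} (e : v ⟶ v), Quiver.reverse e ≠ e

/-- A graph of groups over the graph `V`. The edge groups `A_e` and `A_{e⁻¹}` are identified by
the isomorphisms `flip`, under which `α_{e⁻¹} = ω_e` and `ω_{e⁻¹} = α_e`. -/
structure GraphOfGroups (V : Type u) [SerreGraph.{u, w} V] where
  /-- The vertex groups `A_v`. -/
  vertexGroup : V → Type x
  [vertexGroupGroup : ∀ v, Group (vertexGroup v)]
  /-- The edge groups `A_e`. -/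
  edgeGroup : ∀ {u v : V}, (u ⟶ v) → Type y
  [edgeGroupGroup : ∀ {u v : V} (e : u ⟶ v), Group (edgeGroup e)]
  /-- The boundary monomorphism `α_e : A_e → A_{o(e)}`. -/
  α : ∀ {u v : V} (e : u ⟶ v), edgeGroup e →* vertexGroup u
  /-- The boundary monomorphism `ω_e : A_e → A_{t(e)}`. -/
  ω : ∀ {u v : V} (e : u ⟶ v), edgeGroup e →* vertexGroup v
  α_injective : ∀ {u v : V} (e : u ⟶ v), Function.Injective (α e)
  ω_injective : ∀ {u v : V} (e : u ⟶ v), Function.Injective (ω e)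
  /-- The identification of `A_e` with `A_{e⁻¹}`. -/
  flip : ∀ {u v : V} (e : u ⟶ v), edgeGroup e ≃* edgeGroup (Quiver.reverse e)
  α_flip : ∀ {u v : V} (e : u ⟶ v) (c : edgeGroup e), α (Quiver.reverse e) (flip e c) = ω e c
  ω_flip : ∀ {u v : V} (e : u ⟶ v) (c : edgeGroup e), ω (Quiver.reverse e) (flip e c) = α e c

namespace GraphOfGroups

attribute [instance] vertexGroupGroup edgeGroupGroup

variable {V : Type u} [SerreGraph.{u, w} V] (A : GraphOfGroups.{u, w, x, y} V)

/-- `𝔸`-paths `a₀, e₁, a₁, …, e_k, a_k` from a vertex to a vertex: `nil a` is the path `a` of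
length zero, and `cons a e p` is the path `a, e, p`. -/
inductive APath : V → V → Type (max u w x)
  | nil {v : V} (a : A.vertexGroup v) : APath v v
  | cons {u v v' : V} (a : A.vertexGroup u) (e : u ⟶ v) (p : APath v v') : APath u v'

namespace APath

variable {A}

/-- Left multiplication of the first group element of a path. -/
def lmul : ∀ {v v' : V}, A.vertexGroup v → APath A v v' → APath A v v'
  | _, _, a, nil b => nil (a * b)
  | _, _, a, cons b e p => cons (a * b) e p

/-- Concatenation: the last group element of the first path is multiplied with the first group
element of the second path. -/
def append : ∀ {v v' v'' : V}, APath A v v' → APath A v' v'' → APath A v v''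
  | _, _, _, nil a, q => lmul a q
  | _, _, _, cons a e p, q => cons a e (append p q)

/-- The inverse path `a_k⁻¹, e_k⁻¹, …, a₁⁻¹, e₁⁻¹, a₀⁻¹`. -/
def inv : ∀ {v v' : V}, APath A v v' → APath A v' v
  | _, _, nil a => nil a⁻¹
  | _, _, cons a e p => append (inv p) (cons 1 (Quiver.reverse e) (nil a⁻¹))

/-- The equivalence relation `∼` on `𝔸`-paths generated (modulo concatenation) by
`a, e, ω_e(c), e⁻¹, a' ∼ a α_e(c) a'`. -/
inductive Equivalent : ∀ {v v' : V}, APath A v v' → APath A v v' → Prop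
  | reduce {u v : V} (e : u ⟶ v) (c : A.edgeGroup e) (a a' : A.vertexGroup u) :
      Equivalent (cons a e (cons (A.ω e c) (Quiver.reverse e) (nil a'))) (nil (a * A.α e c * a'))
  | refl {v v' : V} (p : APath A v v') : Equivalent p p
  | symm {v v' : V} {p q : APath A v v'} : Equivalent p q → Equivalent q p
  | trans {v v' : V} {p q r : APath A v v'} : Equivalent p q → Equivalent q r → Equivalent p r
  | append {v v' v'' : V} {p p' : APath A v v'} {q q' : APath A v' v''} :
      Equivalent p p' → Equivalent q q' → Equivalent (p.append q) (p'.append q')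

lemma lmul_lmul {v v' : V} (a b : A.vertexGroup v) (p : APath A v v') :
    lmul a (lmul b p) = lmul (a * b) p := by
  cases p <;> simp [lmul, mul_assoc]

lemma one_lmul {v v' : V} (p : APath A v v') : lmul 1 p = p := by
  cases p <;> simp [lmul]

lemma lmul_append {v v' v'' : V} (a : A.vertexGroup v) (p : APath A v v') (q : APath A v' v'') :
    (lmul a p).append q = lmul a (p.append q) := by
  cases p with
  | nil b => exact (lmul_lmul a b q).symm
  | cons b e p => rfl

lemma append_assoc {v₁ v₂ v₃ v₄ : V} (p : APath A v₁ v₂) (q : APath A v₂ v₃) (r : APath A v₃ v₄) :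
    (p.append q).append r = p.append (q.append r) := by
  induction p with
  | nil a => simp [append, lmul_append]
  | cons a e p ih => simp [append, ih]

lemma append_one {v v' : V} (p : APath A v v') : p.append (nil 1) = p := by
  induction p with
  | nil a => simp [append, lmul]
  | cons a e p ih => simp [append, ih]

lemma one_append {v v' : V} (p : APath A v v') : (nil 1 : APath A v v).append p = p :=
  one_lmul p

lemma inv_lmul {v v' : V} (a : A.vertexGroup v) (p : APath A v v') :
    (lmul a p).inv = p.inv.append (nil a⁻¹) := by
  cases p <;> simp [lmul, inv, append, append_assoc]

lemma inv_append {v v' v'' : V} (p : APath A v v') (q : APath A v' v'') :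
    (p.append q).inv = q.inv.append p.inv := by
  induction p with
  | nil a => simp [append, inv, inv_lmul]
  | cons a e p ih => simp [append, inv, ih, append_assoc]

lemma Equivalent.inv {v v' : V} {p q : APath A v v'} (h : Equivalent p q) :
    Equivalent p.inv q.inv := by
  induction h with
  | @reduce u v e c a a' =>
    have key := Equivalent.reduce (A := A) e c⁻¹ a'⁻¹ a⁻¹
    simpa [APath.inv, APath.append, lmul, mul_assoc] using key
  | refl p => exact .refl _
  | symm _ ih => exact .symm ih
  | trans _ _ ih₁ ih₂ => exact .trans ih₁ ih₂
  | append _ _ ih₁ ih₂ => rw [inv_append, inv_append]; exact .append ih₂ ih₁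

lemma append_inv {v v' : V} (p : APath A v v') : Equivalent (p.append p.inv) (nil 1) := by
  induction p with
  | nil a => simpa [append, inv, lmul] using Equivalent.refl _
  | @cons u v v' a e p ih =>
    have h₁ : (cons a e p).append (cons a e p).inv =
        ((cons a e (nil 1)).append (p.append p.inv)).append
          (cons 1 (Quiver.reverse e) (nil a⁻¹)) := by
      simp [append, inv, append_assoc, one_lmul]
    rw [h₁]
    refine .trans (.append (.append (.refl _) ih) (.refl _)) ?_
    have key := Equivalent.reduce (A := A) e 1 a a⁻¹
    simpa [append, lmul] using key

instance setoid (v v' : V) : Setoid (APath A v v') where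
  r := Equivalent
  iseqv := ⟨.refl, .symm, .trans⟩

end APath

/-- The fundamental group `π₁(𝔸, v₀)`: equivalence classes of `𝔸`-paths from `v₀` to `v₀`. -/
def FundamentalGroup (v₀ : V) : Type (max u w x) :=
  Quotient (APath.setoid (A := A) v₀ v₀)

namespace FundamentalGroup

variable {A} {v₀ : V}

instance : Mul (FundamentalGroup A v₀) :=
  ⟨Quotient.map₂ APath.append fun _ _ h _ _ h' => APath.Equivalent.append h h'⟩

instance : One (FundamentalGroup A v₀) := ⟨Quotient.mk _ (APath.nil 1)⟩

instance : Inv (FundamentalGroup A v₀) :=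
  ⟨Quotient.map APath.inv fun _ _ h => APath.Equivalent.inv h⟩

instance : Group (FundamentalGroup A v₀) :=
  Group.ofRightAxioms
    (by
      rintro ⟨p⟩ ⟨q⟩ ⟨r⟩
      exact congrArg (Quotient.mk _) (APath.append_assoc p q r))
    (by
      rintro ⟨p⟩
      exact congrArg (Quotient.mk _) (APath.append_one p))
    (by
      rintro ⟨p⟩
      exact Quotient.sound (APath.append_inv p))

end FundamentalGroup

open GroupAlgorithms in
/-- Benign graphs of groups. -/
structure IsBenign : Prop where
  finite_vertices : Finite V
  finite_edges : ∀ u v : V, Finite (u ⟶ v)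
  connected : Quiver.IsStronglyConnected V
  vertexGroup_fg : ∀ v, Group.FG (A.vertexGroup v)
  edgeGroup_fg : ∀ {u v : V} (e : u ⟶ v), Group.FG (A.edgeGroup e)
  /-- Given a finite `X ⊆ A_v` and `a ∈ A_v`, where `v = o(e)`, one can decide whether
  `⟨X⟩ ∩ a α_e(A_e)` is empty and, if it is not, find an element of it. -/
  coset_intersection : ∀ {u v : V} (e : u ⟶ v), SolvableCosetIntersection (A.α e).range
  /-- Edge groups are Noetherian: there is no infinite strictly ascending sequence of subgroups. -/
  noetherian : ∀ {u v : V} (e : u ⟶ v), WellFoundedGT (Subgroup (A.edgeGroup e))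
  /-- Edge groups have solvable uniform membership problem. -/
  edge_membership : ∀ {u v : V} (e : u ⟶ v), SolvableUniformMembership (A.edgeGroup e)
  /-- Given a finite `X ⊆ A_v`, where `v = o(e)`, one can compute a finite generating set of
  `α_e(A_e) ∩ ⟨X⟩`. -/
  intersection : ∀ {u v : V} (e : u ⟶ v), ComputableIntersection (A.α e).range

end GraphOfGroups

/-!
Membership in finitely generated subgroups of the fundamental group `G` of a graph of groups is
shown to be decidable by Post's theorem: both the membership predicate and its complement are
recursively enumerable.

*Membership.* `G` is generated by the generators of the vertex groups and the edges, and has a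
recursively enumerable set of relators with respect to these generators
(`wordVal_eq_one_of_relators`). An element lies in `⟨X⟩` iff a word for it lies in the subgroup of
the free group generated by `X` and the conjugates of the relators, and the subgroup of a free group
generated by a recursively enumerable set is recursively enumerable (`re_mk_mem_closure`).

*Non-membership.* An element `g` is outside of `H = ⟨X⟩` iff there are an action of the graph of
groups (a set with an action of `A_v` for each vertex `v` and compatible bijections along the edges)
and a point which is fixed by `H` and not by `g`; one such action is that on the cosets of `H`. A
finite part of an action can be written down as a table: finitely many orbits of vertex groups, with
finitely many generators for the stabilizer of a base point of each, and finitely many edges between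
points of these orbits. A table is valid if translates of its edges by the edge groups are partial
bijections; for a benign graph of groups this can be verified. Two facts make valid tables with
suitable readings of `X` and `g` into certificates for `g ∉ H`.

* Soundness (`Coding.Valid.exists_action`): every valid table is part of an action. All partial
  bijections live on the sets of sequences of subsets of the vertex groups. There, every set
  occurring embeds equivariantly into the part of any other one which the partial bijections do not
  meet, so that they extend to bijections by an equivariant Schröder–Bernstein argument
  (`exists_action_extension`).
* Completeness (`Action.exists_table`): finitely many paths in an action are read in a valid table.
  The stabilizers in the vertex groups need not be finitely generated, but they can be replaced by
  subgroups generated by finitely many of their elements. A valid table results as soon as these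
  subgroups contain the images of the stabilizers in the edge groups of the finitely many edges in
  question. The latter stabilizers are finitely generated because the edge groups are Noetherian.
-/

universe z

/-! ### Recursively enumerable predicates -/

namespace REPred

variable {α β : Type*} [Primcodable α] [Primcodable β]

theorem of_primrec {p : α → Prop} {D : α → ℕ → Bool} (hD : Primrec₂ D)
    (h : ∀ a, p a ↔ ∃ k, D a k = true) : REPred p := by
  have hf : Partrec fun a => Nat.rfind ((D a : ℕ → Bool) : ℕ →. Bool) :=
    Partrec.rfind (hD.to_comp.partrec₂)
  refine hf.dom_re.of_eq fun a => ?_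
  rw [h]
  refine Nat.rfind_dom.trans ⟨fun ⟨k, hk, _⟩ => ⟨k, ?_⟩, fun ⟨k, hk⟩ => ⟨k, ?_, ?_⟩⟩
  · exact (Part.mem_some_iff.1 hk).symm
  · exact Part.mem_some_iff.2 hk.symm
  · intro m _
    trivial

/-- A predicate is recursively enumerable iff it holds of `a` exactly when a primitive recursive
search, monotone in its bound, succeeds for some bound. -/
theorem iff_exists_primrec {p : α → Prop} :
    REPred p ↔ ∃ D : α → ℕ → Bool, Primrec₂ D ∧
      (∀ a m n, m ≤ n → D a m = true → D a n = true) ∧ ∀ a, p a ↔ ∃ k, D a k = true := by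
  constructor
  · intro h
    obtain ⟨c, hc⟩ := Nat.Partrec.Code.exists_code.1 h
    refine ⟨fun a k => (Nat.Partrec.Code.evaln k c (Encodable.encode a)).isSome, ?_, ?_, ?_⟩
    · exact Primrec.option_isSome.comp (Nat.Partrec.Code.primrec_evaln.comp
        ((Primrec.snd.pair (Primrec.const c)).pair (Primrec.encode.comp Primrec.fst)))
    · intro a m n hmn hm
      obtain ⟨x, hx⟩ := Option.isSome_iff_exists.1 hm
      exact Option.isSome_iff_exists.2 ⟨x, Nat.Partrec.Code.evaln_mono hmn hx⟩
    · intro a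
      have key : p a ↔ (c.eval (Encodable.encode a)).Dom := by
        rw [hc]
        simp [Part.assert]
      rw [key, Part.dom_iff_mem]
      constructor
      · rintro ⟨x, hx⟩
        obtain ⟨k, hk⟩ := Nat.Partrec.Code.evaln_complete.1 hx
        exact ⟨k, Option.isSome_iff_exists.2 ⟨x, hk⟩⟩
      · rintro ⟨k, hk⟩
        obtain ⟨x, hx⟩ := Option.isSome_iff_exists.1 hk
        exact ⟨x, Nat.Partrec.Code.evaln_sound hx⟩
  · rintro ⟨D, hD, -, h⟩
    exact of_primrec hD h

theorem comp {p : β → Prop} (hp : REPred p) {f : α → β} (hf : Computable f) :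
    REPred fun a => p (f a) :=
  Partrec.comp hp hf

theorem and {p q : α → Prop} (hp : REPred p) (hq : REPred q) : REPred fun a => p a ∧ q a := by
  obtain ⟨D, hD, mD, h⟩ := iff_exists_primrec.1 hp
  obtain ⟨D', hD', mD', h'⟩ := iff_exists_primrec.1 hq
  refine of_primrec (D := fun a k => D a k && D' a k) (Primrec.and.comp₂ hD hD') fun a => ?_
  rw [h, h']
  constructor
  · rintro ⟨⟨k, hk⟩, ⟨l, hl⟩⟩
    exact ⟨max k l, by simp [mD a k _ (le_max_left k l) hk, mD' a l _ (le_max_right k l) hl]⟩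
  · rintro ⟨k, hk⟩
    simp only [Bool.and_eq_true] at hk
    exact ⟨⟨k, hk.1⟩, ⟨k, hk.2⟩⟩

theorem or {p q : α → Prop} (hp : REPred p) (hq : REPred q) : REPred fun a => p a ∨ q a := by
  obtain ⟨D, hD, -, h⟩ := iff_exists_primrec.1 hp
  obtain ⟨D', hD', -, h'⟩ := iff_exists_primrec.1 hq
  refine of_primrec (D := fun a k => D a k || D' a k) (Primrec.or.comp₂ hD hD') fun a => ?_
  rw [h, h']
  simp [exists_or]

theorem exists_snd {p : α → β → Prop} (hp : REPred fun x : α × β => p x.1 x.2) :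
    REPred fun a => ∃ b, p a b := by
  obtain ⟨D, hD, -, h⟩ := iff_exists_primrec.1 hp
  refine of_primrec
    (D := fun a k => ((Encodable.decode (α := β) k.unpair.1).map
      fun b => D (a, b) k.unpair.2).getD false) ?_ fun a => ?_
  · refine Primrec.option_getD.comp (Primrec.option_map
      (Primrec.decode.comp (Primrec.fst.comp (Primrec.unpair.comp Primrec.snd))) ?_)
      (Primrec.const false)
    exact hD.comp ((Primrec.fst.comp Primrec.fst).pair Primrec.snd)
      (Primrec.snd.comp (Primrec.unpair.comp (Primrec.snd.comp Primrec.fst)))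
  · constructor
    · rintro ⟨b, hb⟩
      obtain ⟨k, hk⟩ := (h (a, b)).1 hb
      exact ⟨Nat.pair (Encodable.encode b) k, by simpa using hk⟩
    · rintro ⟨k, hk⟩
      cases hd : (Encodable.decode (α := β) k.unpair.1) with
      | none => simp [hd] at hk
      | some b => exact ⟨b, (h (a, b)).2 ⟨_, by simpa [hd] using hk⟩⟩

/-- Recursively enumerable predicates are closed under quantification over the members of a
list. -/
theorem forall_mem {p : α → β → Prop} (hp : REPred fun x : α × β => p x.1 x.2)
    {f : α → List β} (hf : Computable f) : REPred fun a => ∀ b ∈ f a, p a b := by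
  have key : REPred fun x : α × List β => ∀ b ∈ x.2, p x.1 b := by
    obtain ⟨D, hD, mD, h⟩ := iff_exists_primrec.1 hp
    refine of_primrec (p := fun x : α × List β => ∀ b ∈ x.2, p x.1 b)
      (D := fun x k => x.2.foldr (fun b r => D (x.1, b) k && r) true) ?_ fun x => ?_
    · have h₁ : Primrec fun y : ((α × List β) × ℕ) × (β × Bool) => D (y.1.1.1, y.2.1) y.1.2 :=
        hD.comp (((Primrec.fst.comp (Primrec.fst.comp Primrec.fst))).pair
          (Primrec.fst.comp Primrec.snd)) (Primrec.snd.comp Primrec.fst)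
      have h₀ : Primrec fun y : (α × List β) × ℕ => y.1.2 := Primrec.snd.comp Primrec.fst
      exact Primrec.list_foldr (h := fun y z => D (y.1.1, z.1) y.2 && z.2) h₀
        (Primrec.const true) (Primrec.and.comp h₁ (Primrec.snd.comp Primrec.snd))
    · have hall : ∀ (l : List β) (k : ℕ), l.foldr (fun b r => D (x.1, b) k && r) true = true ↔
          ∀ b ∈ l, D (x.1, b) k = true := by
        intro l k
        induction l with
        | nil => simp
        | cons b l ih => simp [ih]
      simp only [hall]
      clear hall
      obtain ⟨a, l⟩ := x
      dsimp only
      induction l with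
      | nil => simp
      | cons b l ih =>
        simp only [List.forall_mem_cons] at ih ⊢
        refine (and_congr (h (a, b)) ih).trans ?_
        constructor
        · rintro ⟨⟨k, hk⟩, ⟨m, hm⟩⟩
          exact ⟨max k m, mD _ _ _ (le_max_left _ _) hk,
            fun c hc => mD _ _ _ (le_max_right _ _) (hm c hc)⟩
        · rintro ⟨k, hk, hk'⟩
          exact ⟨⟨k, hk⟩, ⟨k, hk'⟩⟩
  exact key.comp (Computable.id.pair hf)

theorem const (p : Prop) : REPred fun _ : α => p := by
  classical
  exact ComputablePred.to_re (ComputablePred.computable_iff.2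
    ⟨fun _ => decide p, Computable.const _, by simp⟩)

theorem eq {f g : α → β} (hf : Computable f) (hg : Computable g) : REPred fun a => f a = g a := by
  classical
  have h : PrimrecPred fun x : β × β => x.1 = x.2 := Primrec.eq
  exact h.computablePred.to_re.comp (hf.pair hg)

theorem ne {f g : α → β} (hf : Computable f) (hg : Computable g) : REPred fun a => f a ≠ g a := by
  classical
  have h : PrimrecPred fun x : β × β => ¬ (x.1 = x.2) := PrimrecPred.not Primrec.eq
  exact h.computablePred.to_re.comp (hf.pair hg)

/-- Finitely many recursively enumerable predicates form one recursively enumerable predicate in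
the index and the argument. -/
theorem finite_index {ι : Type*} [Finite ι] [Primcodable ι] {p : ι → α → Prop}
    (hp : ∀ i, REPred (p i)) : REPred fun x : ι × α => p x.1 x.2 := by
  classical
  have : Fintype ι := Fintype.ofFinite ι
  have key : ∀ s : Finset ι, REPred fun x : ι × α => ∃ i ∈ s, x.1 = i ∧ p i x.2 := by
    intro s
    induction s using Finset.induction_on with
    | empty => simpa using const False
    | insert i s _ ih =>
      refine (((eq Computable.fst (Computable.const i)).and
        ((hp i).comp Computable.snd)).or ih).of_eq fun x => ?_
      rw [Finset.exists_mem_insert]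
  refine (key Finset.univ).of_eq fun x => ?_
  simp

theorem mem_list {f : α → β} {l : α → List β} (hf : Computable f) (hl : Computable l) :
    REPred fun a => f a ∈ l a := by
  have h : PrimrecRel fun (L : List β) (b : β) => ∃ a ∈ L, a = b :=
    PrimrecRel.exists_mem_list Primrec.eq
  have h' : REPred fun x : List β × β => ∃ a ∈ x.1, a = x.2 :=
    ComputablePred.to_re (PrimrecPred.computablePred h)
  exact (h'.comp (hl.pair hf)).of_eq fun a => by simp

end REPred

/-! ### Words -/

namespace GroupAlgorithms

section Words

variable {G : Type*} [Group G] {n m : ℕ}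

lemma wordVal_nil (x : Fin n → G) : wordVal x [] = 1 := by simp [wordVal]

lemma wordVal_eq_lift (x : Fin n → G) (l : Word n) :
    wordVal x l = FreeGroup.lift x (FreeGroup.mk l) := by
  rw [FreeGroup.lift_mk]
  rfl

lemma wordVal_invRev (x : Fin n → G) (l : Word n) :
    wordVal x (FreeGroup.invRev l) = (wordVal x l)⁻¹ := by
  rw [wordVal_eq_lift, wordVal_eq_lift, ← FreeGroup.inv_mk, map_inv]

/-- Substituting for each letter a word with the same value does not change the value of a word. -/
lemma wordVal_flatMap {x : Fin n → G} {y : Fin m → G} {c : Fin m × Bool → Word n}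
    (hc : ∀ s, wordVal x (c s) = cond s.2 (y s.1) (y s.1)⁻¹) (l : Word m) :
    wordVal x (l.flatMap c) = wordVal y l := by
  induction l with
  | nil => simp [wordVal]
  | cons s l ih =>
    rw [List.flatMap_cons, wordVal_append, ih, hc]
    simp [wordVal]

lemma map_wordVal {H : Type*} [Group H] (f : G →* H) (x : Fin n → G) (l : Word n) :
    f (wordVal x l) = wordVal (fun i => f (x i)) l := by
  rw [wordVal_eq_lift, wordVal_eq_lift, ← MonoidHom.comp_apply]
  congr 1
  ext i
  simp

lemma wordVal_mem_spanWords (x : Fin n → G) {X : List (Word n)} {l : Word n} (h : l ∈ X) :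
    wordVal x l ∈ spanWords x X :=
  Subgroup.subset_closure ⟨l, h, rfl⟩

lemma spanWords_le (x : Fin n → G) {X : List (Word n)} {K : Subgroup G} :
    spanWords x X ≤ K ↔ ∀ l ∈ X, wordVal x l ∈ K := by
  unfold spanWords
  rw [Subgroup.closure_le]
  constructor
  · exact fun h l hl => h ⟨l, hl, rfl⟩
  · rintro h _ ⟨l, hl, rfl⟩
    exact h l hl

lemma spanWords_map_map {H : Type*} [Group H] (f : G →* H) (x : Fin n → G) (y : Fin m → H)
    (τ : Word n → Word m) (hτ : ∀ l, wordVal y (τ l) = f (wordVal x l)) (X : List (Word n)) :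
    spanWords y (X.map τ) = (spanWords x X).map f := by
  apply le_antisymm
  · rw [spanWords_le]
    intro l hl
    obtain ⟨k, hk, rfl⟩ := List.mem_map.1 hl
    exact ⟨_, wordVal_mem_spanWords x hk, (hτ k).symm⟩
  · rw [Subgroup.map_le_iff_le_comap, spanWords_le]
    intro l hl
    rw [Subgroup.mem_comap, ← hτ]
    exact wordVal_mem_spanWords y (List.mem_map_of_mem hl)

lemma countable_of_generates {x : Fin n → G} (hx : Generates x) : Countable G :=
  Function.Surjective.countable (f := wordVal x) fun g => exists_word hx g

lemma Generates.pad {x : Fin n → G} (hx : Generates x) (h : n ≤ m) :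
    ∃ y : Fin m → G, Generates y := by
  refine ⟨fun i => if hi : i.1 < n then x ⟨i, hi⟩ else 1, ?_⟩
  unfold Generates at *
  rw [eq_top_iff, ← hx, Subgroup.closure_le]
  rintro _ ⟨i, rfl⟩
  exact Subgroup.subset_closure ⟨⟨i, i.2.trans_le h⟩, by simp⟩

/-- Finitely many finitely generated groups have generating tuples of a common length. -/
lemma exists_common_length {ι : Type*} [Finite ι] {Γ : ι → Type*} [∀ i, Group (Γ i)]
    (h : ∀ i, ∃ (n : ℕ) (x : Fin n → Γ i), Generates x) :
    ∃ N, ∀ n, N ≤ n → ∀ i, ∃ x : Fin n → Γ i, Generates x := by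
  choose n x hx using h
  obtain ⟨N, hN⟩ := (Set.finite_range n).bddAbove
  exact ⟨N, fun k hk i => (hx i).pad ((hN ⟨i, rfl⟩).trans hk)⟩

/-- Between two generating tuples, words are translated by substitution. -/
lemma exists_translation {x : Fin n → G} (hx : Generates x) (y : Fin m → G) :
    ∃ τ : Word m → Word n, Primrec τ ∧ ∀ l, wordVal x (τ l) = wordVal y l := by
  choose c hc using fun s : Fin m × Bool => exists_word hx (cond s.2 (y s.1) (y s.1)⁻¹)
  exact ⟨fun l => l.flatMap c,
    Primrec.list_flatMap Primrec.id ((Primrec.dom_finite c).comp Primrec.snd).to₂,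
    wordVal_flatMap hc⟩

/-- The emptiness of `⟨X⟩ ∩ aH` is decidable with respect to every tuple. -/
lemma SolvableCosetIntersection.disjoint_re {H : Subgroup G} (h : SolvableCosetIntersection H)
    (y : Fin m → G) : REPred fun p : List (Word m) × Word m =>
      ∀ c ∈ H, wordVal y p.2 * c ∉ spanWords y p.1 := by
  obtain ⟨n, x, hx, f, hf, hfs⟩ := h
  obtain ⟨τ, pτ, hτ⟩ := exists_translation hx y
  have pT : Primrec fun p : List (Word m) × Word m => (p.1.map τ, τ p.2) :=
    (Primrec.list_map Primrec.fst (pτ.comp Primrec.snd).to₂).pair (pτ.comp Primrec.snd)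
  have hspan : ∀ X, spanWords x (X.map τ) = spanWords y X := fun X => by
    rw [spanWords_map_map (MonoidHom.id G) y x τ (fun l => by simp [hτ]), Subgroup.map_id]
  refine (REPred.eq (hf.comp pT.to_comp) (Computable.const none)).of_eq fun p => ?_
  obtain ⟨h₁, h₂⟩ := hfs (p.1.map τ) (τ p.2)
  rw [hspan, hτ] at h₁
  simp only [hspan, hτ] at h₂
  constructor
  · intro hn c hc hmem
    have : wordVal y p.2 * c ∈ (∅ : Set G) := by
      rw [← h₁ hn]
      exact ⟨hmem, c, hc, rfl⟩
    exact this
  · intro hdis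
    cases hfp : f (p.1.map τ, τ p.2) with
    | none => rfl
    | some b =>
      obtain ⟨hb, c, hc, hbc⟩ := h₂ b hfp
      rw [← hbc] at hb
      exact (hdis c hc hb).elim

/-- The algorithm for generators of `H ∩ ⟨X⟩` exists with respect to every generating tuple. -/
lemma ComputableIntersection.exists_computable {H : Subgroup G} (h : ComputableIntersection H)
    {y : Fin m → G} (hy : Generates y) : ∃ f : List (Word m) → List (Word m), Computable f ∧
      ∀ X, spanWords y (f X) = H ⊓ spanWords y X := by
  obtain ⟨n, x, hx, f, hf, hfs⟩ := h
  obtain ⟨τ, pτ, hτ⟩ := exists_translation hx y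
  obtain ⟨ρ, pρ, hρ⟩ := exists_translation hy x
  refine ⟨fun X => (f (X.map τ)).map ρ, ?_, fun X => ?_⟩
  · exact (Primrec.list_map Primrec.id (pρ.comp Primrec.snd).to₂).to_comp.comp
      (hf.comp (Primrec.list_map Primrec.id (pτ.comp Primrec.snd).to₂).to_comp)
  · rw [spanWords_map_map (MonoidHom.id G) x y ρ (fun l => by simp [hρ]), Subgroup.map_id, hfs,
      spanWords_map_map (MonoidHom.id G) y x τ (fun l => by simp [hτ]), Subgroup.map_id]

end Words

section Enumeration

variable {α : Type*} [Primcodable α] {n : ℕ}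

lemma primrec_invRev : Primrec (FreeGroup.invRev : Word n → Word n) :=
  Primrec.list_reverse.comp (Primrec.list_map Primrec.id
    (((Primrec.fst.comp Primrec.snd).pair
      (Primrec.not.comp (Primrec.snd.comp Primrec.snd))).to₂))

lemma primrec_reduce : Primrec (FreeGroup.reduce : Word n → Word n) := by
  let Y := (Word n × ((Fin n × Bool) × Word n)) × ((Fin n × Bool) × Word n)
  have pa : Primrec fun z : Y => z.1.2.1 := Primrec.fst.comp (Primrec.snd.comp Primrec.fst)
  have pb : Primrec fun z : Y => z.2.1 := Primrec.fst.comp Primrec.snd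
  have pl : Primrec fun z : Y => z.2.2 := Primrec.snd.comp Primrec.snd
  have hc : PrimrecPred fun z : Y => z.1.2.1.1 = z.2.1.1 ∧ z.1.2.1.2 = !z.2.1.2 :=
    (Primrec.eq.comp (Primrec.fst.comp pa) (Primrec.fst.comp pb)).and
      (Primrec.eq.comp (Primrec.snd.comp pa) (Primrec.not.comp (Primrec.snd.comp pb)))
  have hh : Primrec fun z : Y => if z.1.2.1.1 = z.2.1.1 ∧ z.1.2.1.2 = !z.2.1.2 then z.2.2 else
      z.1.2.1 :: z.2.1 :: z.2.2 :=
    Primrec.ite hc pl (Primrec.list_cons.comp pa (Primrec.list_cons.comp pb pl))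
  have hg : Primrec fun y : Word n × ((Fin n × Bool) × Word n) => [y.2.1] :=
    Primrec.list_cons.comp (Primrec.fst.comp Primrec.snd) (Primrec.const [])
  have hs : Primrec₂ fun (_ : Word n) (z : (Fin n × Bool) × Word n) =>
      (List.casesOn z.2 [z.1] fun hd tl =>
        if z.1.1 = hd.1 ∧ z.1.2 = !hd.2 then tl else z.1 :: hd :: tl : Word n) :=
    Primrec.list_casesOn (Primrec.snd.comp Primrec.snd) hg hh.to₂
  refine (Primrec.list_foldr Primrec.id (Primrec.const []) hs).of_eq fun l => ?_
  induction l with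
  | nil => rfl
  | cons a l ih =>
    rw [FreeGroup.reduce.cons, ← ih]
    rfl

/-- In a free group, the subgroup generated by a recursively enumerable set of words is
recursively enumerable. -/
theorem re_mk_mem_closure {p : α → Word n → Prop} (hp : REPred fun x : α × Word n => p x.1 x.2) :
    REPred fun x : α × Word n =>
      FreeGroup.mk x.2 ∈ Subgroup.closure {g | ∃ w, p x.1 w ∧ FreeGroup.mk w = g} := by
  let s : Bool × Word n → Word n := fun t => cond t.1 t.2 (FreeGroup.invRev t.2)
  have ps : Primrec s := Primrec.cond Primrec.fst Primrec.snd (primrec_invRev.comp Primrec.snd)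
  have pF : Primrec fun T : List (Bool × Word n) => T.flatMap s :=
    Primrec.list_flatMap Primrec.id (ps.comp Primrec.snd).to₂
  have key : REPred fun x : α × Word n => ∃ T : List (Bool × Word n), (∀ t ∈ T, p x.1 t.2) ∧
      FreeGroup.reduce (T.flatMap s) = FreeGroup.reduce x.2 := by
    refine REPred.exists_snd (REPred.and ?_ ?_)
    · have pf : Computable fun y : ((α × Word n) × List (Bool × Word n)) × (Bool × Word n) =>
          (y.1.1.1, y.2.2) :=
        (Computable.fst.comp (Computable.fst.comp Computable.fst)).pair
          (Computable.snd.comp Computable.snd)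
      have hq := hp.comp pf
      exact REPred.forall_mem hq Computable.snd
    · exact REPred.eq (primrec_reduce.comp (pF.comp Primrec.snd)).to_comp
        (primrec_reduce.comp (Primrec.snd.comp Primrec.fst)).to_comp
  refine key.of_eq fun x => ?_
  have hred : ∀ l m : Word n, FreeGroup.reduce l = FreeGroup.reduce m ↔
      FreeGroup.mk l = FreeGroup.mk m := fun l m =>
    ⟨FreeGroup.reduce.exact, fun h => FreeGroup.reduce.sound h⟩
  simp only [hred]
  have hs : ∀ t : Bool × Word n, FreeGroup.mk (s t) =
      cond t.1 (FreeGroup.mk t.2) (FreeGroup.mk t.2)⁻¹ := by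
    rintro ⟨_ | _, t⟩
    · simp [s, FreeGroup.inv_mk]
    · simp [s]
  constructor
  · rintro ⟨T, hT, h⟩
    rw [← h]
    clear h
    induction T with
    | nil => exact Subgroup.one_mem _
    | cons t T ih =>
      rw [List.forall_mem_cons] at hT
      rw [List.flatMap_cons, ← FreeGroup.mul_mk, hs]
      refine Subgroup.mul_mem _ ?_ (ih hT.2)
      have ht : FreeGroup.mk t.2 ∈
          Subgroup.closure {g | ∃ w, p x.1 w ∧ FreeGroup.mk w = g} :=
        Subgroup.subset_closure ⟨_, hT.1, rfl⟩
      cases t.1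
      · exact Subgroup.inv_mem _ ht
      · exact ht
  · intro h
    generalize FreeGroup.mk x.2 = g at h
    induction h using Subgroup.closure_induction'' with
    | mem g hg =>
      obtain ⟨w, hw, rfl⟩ := hg
      exact ⟨[(true, w)], by simpa using hw, by simp [s]⟩
    | inv_mem g hg =>
      obtain ⟨w, hw, rfl⟩ := hg
      exact ⟨[(false, w)], by simpa using hw, by simp [s, FreeGroup.inv_mk]⟩
    | one => exact ⟨[], by simp, rfl⟩
    | mul g h _ _ ihg ihh =>
      obtain ⟨T, hT, rfl⟩ := ihg
      obtain ⟨S, hS, rfl⟩ := ihh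
      refine ⟨T ++ S, ?_, by rw [List.flatMap_append, FreeGroup.mul_mk]⟩
      intro t ht
      exact (List.mem_append.1 ht).elim (hT t) (hS t)

end Enumeration

/-- A path from `c` to `c'` with label `l` along labelled steps. -/
def Reach {S L : Type*} (step : S → L → S → Prop) : S → List L → S → Prop
  | c, [], c' => c = c'
  | c, a :: l, c' => ∃ d, step c a d ∧ Reach step d l c'

lemma Reach.append {S L : Type*} {step : S → L → S → Prop} {c d e : S} {l m : List L}
    (h : Reach step c l d) (h' : Reach step d m e) : Reach step c (l ++ m) e := by
  induction l generalizing c with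
  | nil => cases h; exact h'
  | cons a l ih =>
    obtain ⟨c', hc, hr⟩ := h
    exact ⟨c', hc, ih hr⟩

lemma Reach.exists_of_append {S L : Type*} {step : S → L → S → Prop} {c e : S} {l m : List L}
    (h : Reach step c (l ++ m) e) : ∃ d, Reach step c l d ∧ Reach step d m e := by
  induction l generalizing c with
  | nil => exact ⟨c, rfl, h⟩
  | cons a l ih =>
    obtain ⟨c', hc, hr⟩ := h
    obtain ⟨d, hd, hd'⟩ := ih hr
    exact ⟨d, ⟨c', hc, hd⟩, hd'⟩

/-- Reachability along recursively enumerable steps is recursively enumerable: a path is a list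
of steps in which each step starts where the previous one ends. -/
theorem reach_re {α S L : Type*} [Primcodable α] [Primcodable S] [Primcodable L]
    {step : α → S → L → S → Prop}
    (h : REPred fun x : α × S × L × S => step x.1 x.2.1 x.2.2.1 x.2.2.2) :
    REPred fun x : α × S × List L × S => Reach (step x.1) x.2.1 x.2.2.1 x.2.2.2 := by
  have key : REPred fun x : α × S × List L × S => ∃ T : List (S × L × S),
      (T.map (fun t => t.2.1) = x.2.2.1 ∧
        T.map (fun t => t.1) ++ [x.2.2.2] = x.2.1 :: T.map (fun t => t.2.2)) ∧
      ∀ t ∈ T, step x.1 t.1 t.2.1 t.2.2 := by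
    let Y := (α × S × List L × S) × List (S × L × S)
    have pT : Primrec fun y : Y => y.2 := Primrec.snd
    have p₁ : Primrec fun y : Y => y.2.map (fun t => t.1) :=
      Primrec.list_map pT (Primrec.fst.comp Primrec.snd).to₂
    have p₂ : Primrec fun y : Y => y.2.map (fun t => t.2.1) :=
      Primrec.list_map pT (Primrec.fst.comp (Primrec.snd.comp Primrec.snd)).to₂
    have p₃ : Primrec fun y : Y => y.2.map (fun t => t.2.2) :=
      Primrec.list_map pT (Primrec.snd.comp (Primrec.snd.comp Primrec.snd)).to₂
    have q₁ : Primrec fun y : Y => y.1.2.1 :=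
      Primrec.fst.comp (Primrec.snd.comp Primrec.fst)
    have q₂ : Primrec fun y : Y => y.1.2.2.1 :=
      Primrec.fst.comp (Primrec.snd.comp (Primrec.snd.comp Primrec.fst))
    have q₃ : Primrec fun y : Y => [y.1.2.2.2] :=
      Primrec.list_cons.comp (Primrec.snd.comp (Primrec.snd.comp (Primrec.snd.comp Primrec.fst)))
        (Primrec.const [])
    refine REPred.exists_snd (REPred.and (REPred.and ?_ ?_) ?_)
    · exact REPred.eq p₂.to_comp q₂.to_comp
    · exact REPred.eq (Primrec.list_append.comp p₁ q₃).to_comp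
        (Primrec.list_cons.comp q₁ p₃).to_comp
    · have pf : Computable fun y : Y × (S × L × S) => (y.1.1.1, y.2) :=
        (Computable.fst.comp (Computable.fst.comp Computable.fst)).pair Computable.snd
      have hq := h.comp pf
      exact REPred.forall_mem (p := fun (y : Y) (t : S × L × S) => step y.1.1 t.1 t.2.1 t.2.2)
        hq Computable.snd
  refine key.of_eq ?_
  rintro ⟨a, c, l, c'⟩
  dsimp only
  induction l generalizing c with
  | nil =>
    constructor
    · rintro ⟨T, ⟨h₁, h₂⟩, -⟩
      obtain rfl := List.map_eq_nil_iff.1 h₁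
      simpa [Reach, eq_comm] using h₂
    · rintro rfl
      exact ⟨[], by simp⟩
  | cons b l ih =>
    constructor
    · rintro ⟨T, ⟨h₁, h₂⟩, h₃⟩
      cases T with
      | nil => simp at h₁
      | cons t T =>
        obtain ⟨t₁, t₂, t₃⟩ := t
        simp only [List.map_cons, List.cons.injEq, List.cons_append] at h₁ h₂
        rw [List.forall_mem_cons] at h₃
        obtain ⟨rfl, h₁⟩ := h₁
        obtain ⟨rfl, h₂⟩ := h₂
        exact ⟨t₃, h₃.1, (ih t₃).1 ⟨T, ⟨h₁, h₂⟩, h₃.2⟩⟩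
    · rintro ⟨d, hd, hr⟩
      obtain ⟨T, ⟨h₁, h₂⟩, h₃⟩ := (ih d).2 hr
      refine ⟨(c, b, d) :: T, ⟨by simp [h₁], by simp [h₂]⟩, ?_⟩
      rw [List.forall_mem_cons]
      exact ⟨hd, h₃⟩

end GroupAlgorithms

/-! ### An equivariant Schröder–Bernstein theorem -/

section SchroederBernstein

variable {C Z W : Type*} [Group C]

/-- The points of `Z` whose backward orbit under two maps `f : Z → W` and `g : W → Z` stops
in `Z`. -/
inductive StopsInSource (f : Z → W) (g : W → Z) : Z → Prop
  | base {p : Z} : p ∉ Set.range g → StopsInSource f g p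
  | step {p : Z} : StopsInSource f g p → StopsInSource f g (g (f p))

lemma StopsInSource.act {actZ : Z → C → Z} {actW : W → C → W}
    (hZ : ∀ p c, actZ (actZ p c) c⁻¹ = p) {f : Z → W} {g : W → Z}
    (hf : ∀ p c, f (actZ p c) = actW (f p) c) (hg : ∀ q c, g (actW q c) = actZ (g q) c)
    {p : Z} (h : StopsInSource f g p) (c : C) : StopsInSource f g (actZ p c) := by
  induction h with
  | @base p hp =>
    refine .base fun ⟨q, hq⟩ => hp ⟨actW q c⁻¹, ?_⟩
    rw [hg, hq, hZ]
  | @step p _ ih =>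
    rw [← hg, ← hf]
    exact .step ih

/-- Two sets with an action of `C` which embed equivariantly into each other are equivariantly
in bijection, by a bijection which agrees at each point with one of the two embeddings. -/
theorem exists_equivariant_equiv {actZ : Z → C → Z} {actW : W → C → W}
    (hZ : ∀ p c, actZ (actZ p c) c⁻¹ = p) {f : Z → W} {g : W → Z}
    (hf : ∀ p c, f (actZ p c) = actW (f p) c) (hg : ∀ q c, g (actW q c) = actZ (g q) c)
    (f_inj : Function.Injective f) (g_inj : Function.Injective g) :
    ∃ h : Z ≃ W, (∀ p c, h (actZ p c) = actW (h p) c) ∧ ∀ p, h p = f p ∨ g (h p) = p := by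
  classical
  have hex : ∀ p, ∃ q, (StopsInSource f g p → q = f p) ∧ (¬ StopsInSource f g p → g q = p) := by
    intro p
    by_cases hp : StopsInSource f g p
    · exact ⟨f p, fun _ => rfl, fun h => (h hp).elim⟩
    · by_cases hr : p ∈ Set.range g
      · obtain ⟨q, hq⟩ := hr
        exact ⟨q, fun h => (hp h).elim, fun _ => hq⟩
      · exact (hp (.base hr)).elim
  choose h h₁ h₂ using hex
  have hinj : Function.Injective h := by
    have mixed : ∀ p q, StopsInSource f g p → ¬ StopsInSource f g q → h p ≠ h q := by
      intro p q hp hq heq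
      apply hq
      rw [← h₂ q hq, ← heq, h₁ p hp]
      exact .step hp
    intro p q hpq
    by_cases hp : StopsInSource f g p <;> by_cases hq : StopsInSource f g q
    · exact f_inj (by rw [← h₁ p hp, ← h₁ q hq, hpq])
    · exact (mixed p q hp hq hpq).elim
    · exact (mixed q p hq hp hpq.symm).elim
    · rw [← h₂ p hp, ← h₂ q hq, hpq]
  have hsurj : Function.Surjective h := by
    intro q
    by_cases hq : StopsInSource f g (g q)
    · generalize hr : g q = r at hq
      cases hq with
      | base hp => exact (hp ⟨q, hr⟩).elim
      | @step p hp => exact ⟨p, by rw [h₁ p hp, g_inj hr]⟩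
    · exact ⟨g q, g_inj (h₂ _ hq)⟩
  refine ⟨Equiv.ofBijective h ⟨hinj, hsurj⟩, fun p c => ?_, fun p => ?_⟩
  · change h (actZ p c) = actW (h p) c
    by_cases hp : StopsInSource f g p
    · rw [h₁ p hp, h₁ _ (hp.act hZ hf hg c), hf]
    · have hp' : ¬ StopsInSource f g (actZ p c) := fun h' => hp (by
        have := h'.act hZ hf hg c⁻¹
        rwa [hZ] at this)
      apply g_inj
      rw [h₂ _ hp', hg, h₂ p hp]
  · by_cases hp : StopsInSource f g p
    · exact .inl (h₁ p hp)
    · exact .inr (h₂ p hp)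

/-- An equivariant partial bijection `R` between two sets with an action of `C` extends to an
equivariant bijection as soon as each set embeds equivariantly into the part of the other one
which `R` does not meet. -/
theorem exists_equivariant_extension {actZ : Z → C → Z} {actW : W → C → W}
    (hZ : ∀ p c, actZ (actZ p c) c⁻¹ = p) {f : Z → W} {g : W → Z}
    (hf : ∀ p c, f (actZ p c) = actW (f p) c) (hg : ∀ q c, g (actW q c) = actZ (g q) c)
    (f_inj : Function.Injective f) (g_inj : Function.Injective g)
    {R : Z → W → Prop} (R_fun : ∀ p q q', R p q → R p q' → q = q')
    (R_inj : ∀ p p' q, R p q → R p' q → p = p') (R_act : ∀ p q c, R p q → R (actZ p c) (actW q c))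
    (f_avoids : ∀ p p', ¬ R p (f p')) (g_avoids : ∀ q q', ¬ R (g q) q') :
    ∃ h : Z ≃ W, (∀ p c, h (actZ p c) = actW (h p) c) ∧ ∀ p q, R p q → h p = q := by
  classical
  have hexf : ∀ p, ∃ q, (∀ q', R p q' → q = q') ∧ ((∀ q', ¬ R p q') → q = f p) := by
    intro p
    by_cases hp : ∃ q, R p q
    · obtain ⟨q, hq⟩ := hp
      exact ⟨q, fun q' h' => R_fun p q q' hq h', fun h' => (h' q hq).elim⟩
    · push Not at hp
      exact ⟨f p, fun q' h' => (hp q' h').elim, fun _ => rfl⟩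
  have hexg : ∀ q, ∃ p, (∀ p', R p' q → p = p') ∧ ((∀ p', ¬ R p' q) → p = g q) := by
    intro q
    by_cases hq : ∃ p, R p q
    · obtain ⟨p, hp⟩ := hq
      exact ⟨p, fun p' h' => R_inj p p' q hp h', fun h' => (h' p hp).elim⟩
    · push Not at hq
      exact ⟨g q, fun q' h' => (hq q' h').elim, fun _ => rfl⟩
  choose F hF₁ hF₂ using hexf
  choose K hK₁ hK₂ using hexg
  have R_act' : ∀ p q c, R (actZ p c) q → R p (F p) ∧ actW (F p) c = q := by
    intro p q c h
    have h' := R_act _ _ c⁻¹ h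
    rw [hZ] at h'
    have hFp : R p (F p) := by rw [hF₁ p _ h']; exact h'
    exact ⟨hFp, R_fun _ _ _ (R_act _ _ c hFp) h⟩
  -- Inverses act as inverses on `W` as well, because `g` is injective and equivariant.
  have hW : ∀ q c, actW (actW q c) c⁻¹ = q := fun q c => g_inj (by rw [hg, hg, hZ])
  have hFe : ∀ p c, F (actZ p c) = actW (F p) c := by
    intro p c
    by_cases hp : ∃ q, R p q
    · obtain ⟨q, hq⟩ := hp
      rw [hF₁ _ _ (R_act _ _ c hq), hF₁ _ _ hq]
    · push Not at hp
      rw [hF₂ p hp, hF₂ _ (fun q' h' => hp _ (R_act' _ _ _ h').1), hf]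
  have hKe : ∀ q c, K (actW q c) = actZ (K q) c := by
    intro q c
    by_cases hq : ∃ p, R p q
    · obtain ⟨p, hp⟩ := hq
      rw [hK₁ _ _ (R_act _ _ c hp), hK₁ _ _ hp]
    · push Not at hq
      refine (hK₂ _ fun p' h' => ?_).trans (by rw [hK₂ q hq, hg])
      have := R_act _ _ c⁻¹ h'
      rw [hW] at this
      exact hq _ this
  have F_inj : Function.Injective F := by
    intro p p' h
    by_cases hp : ∃ q, R p q <;> by_cases hp' : ∃ q, R p' q
    · obtain ⟨q, hq⟩ := hp
      obtain ⟨q', hq'⟩ := hp'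
      rw [hF₁ _ _ hq, hF₁ _ _ hq'] at h
      exact R_inj _ _ _ hq (h ▸ hq')
    · obtain ⟨q, hq⟩ := hp
      push Not at hp'
      rw [hF₁ _ _ hq, hF₂ _ hp'] at h
      exact (f_avoids p p' (h ▸ hq)).elim
    · obtain ⟨q, hq⟩ := hp'
      push Not at hp
      rw [hF₁ _ _ hq, hF₂ _ hp] at h
      exact (f_avoids p' p (h ▸ hq)).elim
    · push Not at hp hp'
      rw [hF₂ _ hp, hF₂ _ hp'] at h
      exact f_inj h
  have K_inj : Function.Injective K := by
    intro q q' h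
    by_cases hq : ∃ p, R p q <;> by_cases hq' : ∃ p, R p q'
    · obtain ⟨p, hp⟩ := hq
      obtain ⟨p', hp'⟩ := hq'
      rw [hK₁ _ _ hp, hK₁ _ _ hp'] at h
      exact R_fun _ _ _ hp (h ▸ hp')
    · obtain ⟨p, hp⟩ := hq
      push Not at hq'
      rw [hK₁ _ _ hp, hK₂ _ hq'] at h
      exact (g_avoids q' q (h ▸ hp)).elim
    · obtain ⟨p, hp⟩ := hq'
      push Not at hq
      rw [hK₁ _ _ hp, hK₂ _ hq] at h
      exact (g_avoids q q' (h ▸ hp)).elim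
    · push Not at hq hq'
      rw [hK₂ _ hq, hK₂ _ hq'] at h
      exact g_inj h
  obtain ⟨h, h₁, h₂⟩ := exists_equivariant_equiv hZ hFe hKe F_inj K_inj
  refine ⟨h, h₁, fun p q hpq => ?_⟩
  obtain h' | h' := h₂ p
  · rw [h', hF₁ _ _ hpq]
  · -- Only points which `R` meets have a preimage under `K` which `R` meets.
    by_cases hq : ∃ p', R p' (h p)
    · obtain ⟨p', hp'⟩ := hq
      rw [hK₁ _ _ hp'] at h'
      rw [h'] at hp'
      exact R_fun _ _ _ hp' hpq
    · push Not at hq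
      rw [hK₂ _ hq] at h'
      rw [← h'] at hpq
      exact (g_avoids _ _ hpq).elim

end SchroederBernstein

namespace GraphOfGroups

/-! ### Sequences of subsets of a group -/

section Shift

variable {C G H : Type*} [Group C] [Group G] [Group H]

/-- The right action of a group on sequences of its subsets by right translation. -/
def shift (s : ℕ → Set G) (a : G) : ℕ → Set G := fun n => {g | g * a⁻¹ ∈ s n}

lemma shift_one (s : ℕ → Set G) : shift s 1 = s := by
  funext n
  ext g
  simp [shift]

lemma shift_mul (s : ℕ → Set G) (a b : G) : shift s (a * b) = shift (shift s a) b := by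
  funext n
  ext g
  simp [shift, mul_assoc]

/-- For homomorphisms `φ : C → G` and `ψ : C → H`, a `C`-equivariant map from sequences of subsets
of `G` to sequences of subsets of `H` whose `0`-th set is everything: a sequence `s` is encoded
as a set of natural numbers, and the values of this code on the `C`-orbit of `s` are recorded
along the image of `ψ`. -/
def spread (enc : G → ℕ) (φ : C →* G) (ψ : C →* H) (s : ℕ → Set G) : ℕ → Set H
  | 0 => Set.univ
  | n + 1 => {h | ∃ d : C, ψ d = h ∧
      ∃ a ∈ shift s (φ d)⁻¹ n.unpair.1, enc a = n.unpair.2}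

lemma spread_shift (enc : G → ℕ) (φ : C →* G) (ψ : C →* H) (s : ℕ → Set G) (c : C) :
    spread enc φ ψ (shift s (φ c)) = shift (spread enc φ ψ s) (ψ c) := by
  funext n
  cases n with
  | zero => simp [spread, shift]
  | succ n =>
    ext h
    simp only [spread, shift, Set.mem_ofPred_eq]
    constructor
    · rintro ⟨d, rfl, a, ha, hn⟩
      exact ⟨d * c⁻¹, by simp, a, by simpa [mul_assoc] using ha, hn⟩
    · rintro ⟨d, hd, a, ha, hn⟩
      exact ⟨d * c, by simp [hd], a, by simpa [mul_assoc] using ha, hn⟩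

lemma spread_injective {enc : G → ℕ} (henc : Function.Injective enc) (φ : C →* G) {ψ : C →* H}
    (hψ : Function.Injective ψ) : Function.Injective (spread enc φ ψ) := by
  intro s t h
  have key : ∀ (s : ℕ → Set G) (n : ℕ) (a : G),
      a ∈ s n ↔ (1 : H) ∈ spread enc φ ψ s (Nat.pair n (enc a) + 1) := by
    intro s n a
    simp only [spread, shift, Set.mem_ofPred_eq, Nat.unpair_pair]
    constructor
    · exact fun ha => ⟨1, by simp, a, by simpa using ha, rfl⟩
    · rintro ⟨d, hd, b, hb, hab⟩
      obtain rfl := henc hab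
      obtain rfl : d = 1 := hψ (by simpa using hd)
      simpa using hb
  funext n
  ext a
  rw [key, key, h]

end Shift

variable {V : Type u} [SerreGraph.{u, w} V] {A : GraphOfGroups.{u, w, x, y} V}

open APath

/-! ### Actions of a graph of groups -/

variable (A) in
/-- A right action of a graph of groups: a set with a right action of `A_v` for each vertex `v`,
and for each edge an `A_e`-equivariant bijection between the sets at its ends, with mutually inverse
bijections for mutually inverse edges. -/
structure Action where
  /-- The set at a vertex. -/
  Pt : V → Type z
  /-- The right action of a vertex group. -/
  act : ∀ {v : V}, Pt v → A.vertexGroup v → Pt v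
  act_one : ∀ {v : V} (p : Pt v), act p 1 = p
  act_mul : ∀ {v : V} (p : Pt v) (a b : A.vertexGroup v), act p (a * b) = act (act p a) b
  /-- The bijection along an edge. -/
  move : ∀ {u v : V}, (u ⟶ v) → Pt u → Pt v
  move_act : ∀ {u v : V} (e : u ⟶ v) (p : Pt u) (c : A.edgeGroup e),
    move e (act p (A.α e c)) = act (move e p) (A.ω e c)
  move_reverse : ∀ {u v : V} (e : u ⟶ v) (p : Pt u), move (Quiver.reverse e) (move e p) = p

namespace FundamentalGroup

variable {v₀ : V}

/-- The element of the fundamental group represented by a closed path. -/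
def mk (p : APath A v₀ v₀) : FundamentalGroup A v₀ := Quotient.mk (APath.setoid v₀ v₀) p

lemma mk_surjective : Function.Surjective (mk : APath A v₀ v₀ → FundamentalGroup A v₀) :=
  Quotient.exists_rep

lemma mk_append (p q : APath A v₀ v₀) : mk (p.append q) = mk p * mk q := rfl

lemma mk_eq_of_equivalent {p q : APath A v₀ v₀} (h : Equivalent p q) : mk p = mk q :=
  Quotient.sound h

end FundamentalGroup

namespace Action

variable (M : Action.{u, w, x, y, z} A)

/-- The translation along an `𝔸`-path. -/
def pathAct : ∀ {v v' : V}, M.Pt v → APath A v v' → M.Pt v'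
  | _, _, p, nil a => M.act p a
  | _, _, p, cons a e q => pathAct (M.move e (M.act p a)) q

lemma pathAct_lmul {v v' : V} (p : M.Pt v) (a : A.vertexGroup v) (q : APath A v v') :
    M.pathAct p (lmul a q) = M.pathAct (M.act p a) q := by
  cases q <;> simp [lmul, pathAct, M.act_mul]

lemma pathAct_append {v v' v'' : V} (p : M.Pt v) (q : APath A v v') (r : APath A v' v'') :
    M.pathAct p (q.append r) = M.pathAct (M.pathAct p q) r := by
  induction q with
  | nil a => exact M.pathAct_lmul p a r
  | cons a e q ih => exact ih _ r

lemma pathAct_eq_of_equivalent {v v' : V} {q q' : APath A v v'} (h : Equivalent q q')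
    (p : M.Pt v) : M.pathAct p q = M.pathAct p q' := by
  induction h with
  | reduce e c a a' =>
    simp only [pathAct]
    rw [← M.move_act, M.move_reverse, M.act_mul, M.act_mul]
  | refl q => rfl
  | symm _ ih => exact (ih p).symm
  | trans _ _ ih₁ ih₂ => exact (ih₁ p).trans (ih₂ p)
  | append _ _ ih₁ ih₂ => rw [pathAct_append, pathAct_append, ih₁, ih₂]

/-- The right action of the fundamental group on the set at the base vertex. -/
def groupAct {v₀ : V} (p : M.Pt v₀) (g : FundamentalGroup A v₀) : M.Pt v₀ :=
  Quotient.lift (s := APath.setoid v₀ v₀) (M.pathAct p)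
    (fun _ _ h => M.pathAct_eq_of_equivalent h p) g

lemma groupAct_mk {v₀ : V} (p : M.Pt v₀) (q : APath A v₀ v₀) :
    M.groupAct p (.mk q) = M.pathAct p q := rfl

lemma groupAct_one {v₀ : V} (p : M.Pt v₀) : M.groupAct p 1 = p := M.act_one p

lemma groupAct_mul {v₀ : V} (p : M.Pt v₀) (g h : FundamentalGroup A v₀) :
    M.groupAct p (g * h) = M.groupAct (M.groupAct p g) h := by
  obtain ⟨q⟩ := g
  obtain ⟨r⟩ := h
  exact M.pathAct_append p q r

/-- The stabilizer of a point at the base vertex. -/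
def stabilizer {v₀ : V} (p : M.Pt v₀) : Subgroup (FundamentalGroup A v₀) where
  carrier := {g | M.groupAct p g = p}
  one_mem' := M.groupAct_one p
  mul_mem' {g h} hg hh := by
    simp only [Set.mem_ofPred_eq] at *
    rw [groupAct_mul, hg, hh]
  inv_mem' {g} hg := by
    simp only [Set.mem_ofPred_eq] at *
    conv_lhs => rw [← hg]
    rw [← groupAct_mul, mul_inv_cancel, groupAct_one]

lemma mem_stabilizer {v₀ : V} {p : M.Pt v₀} {g : FundamentalGroup A v₀} :
    g ∈ M.stabilizer p ↔ M.groupAct p g = p := Iff.rfl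

end Action

/-- The edges of a graph, bundled with their end points. -/
abbrev Edge (V : Type u) [SerreGraph.{u, w} V] : Type max u w := Σ u v : V, (u ⟶ v)

/-- A partial action of a graph of groups with countable vertex groups, on sequences of subsets
of the vertex groups with empty `0`-th set, extends to an action. Sequences whose `0`-th set is
everything are outside of the partial action and leave room for `spread`, so that the partial
bijection along each edge extends. -/
theorem exists_action_extension [Countable (Edge V)] [∀ v, Countable (A.vertexGroup v)]
    (R : ∀ {u v : V}, (u ⟶ v) → (ℕ → Set (A.vertexGroup u)) → (ℕ → Set (A.vertexGroup v)) → Prop)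
    (R_fun : ∀ {u v : V} (e : u ⟶ v) p q q', R e p q → R e p q' → q = q')
    (R_rev : ∀ {u v : V} (e : u ⟶ v) p q, R e p q → R (Quiver.reverse e) q p)
    (R_act : ∀ {u v : V} (e : u ⟶ v) p q (c : A.edgeGroup e), R e p q →
      R e (shift p (A.α e c)) (shift q (A.ω e c)))
    (R_zero : ∀ {u v : V} (e : u ⟶ v) p q, R e p q → p 0 = ∅) :
    ∃ M : Action.{u, w, x, y, x} A, ∃ pt : ∀ {v : V}, (ℕ → Set (A.vertexGroup v)) → M.Pt v,
      (∀ v, Function.Injective (pt (v := v))) ∧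
      (∀ (v : V) (s : ℕ → Set (A.vertexGroup v)) a, pt (shift s a) = M.act (pt s) a) ∧
      ∀ {u v : V} (e : u ⟶ v) p q, R e p q → M.move e (pt p) = pt q := by
  classical
  choose enc henc using fun v => Countable.exists_injective_nat (A.vertexGroup v)
  obtain ⟨idx, hidx⟩ := Countable.exists_injective_nat (Edge V)
  have huniv : ∀ {v : V} {p : ℕ → Set (A.vertexGroup v)}, p 0 = Set.univ → p 0 ≠ ∅ := by
    intro v p h h'
    rw [h] at h'
    exact Set.univ_nonempty.ne_empty h'
  have hext : ∀ {u v : V} (e : u ⟶ v), ∃ h : (ℕ → Set (A.vertexGroup u)) ≃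
      (ℕ → Set (A.vertexGroup v)),
      (∀ p (c : A.edgeGroup e), h (shift p (A.α e c)) = shift (h p) (A.ω e c)) ∧
      ∀ p q, R e p q → h p = q := by
    intro u v e
    refine exists_equivariant_extension (C := A.edgeGroup e)
      (actZ := fun p c => shift p (A.α e c)) (actW := fun q c => shift q (A.ω e c))
      (f := spread (enc u) (A.α e) (A.ω e)) (g := spread (enc v) (A.ω e) (A.α e))
      (fun p c => by simp only [← shift_mul, ← map_mul]; simp [shift_one])
      (spread_shift _ _ _) (spread_shift _ _ _)
      (spread_injective (henc u) _ (A.ω_injective e))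
      (spread_injective (henc v) _ (A.α_injective e))
      (R := R e) (R_fun e) ?_ (fun p q c h => R_act e p q c h) ?_ ?_
    · intro p p' q h h'
      have h₁ := R_rev e _ _ h
      have h₂ := R_rev e _ _ h'
      exact R_fun _ _ _ _ h₁ h₂
    · exact fun p p' h => huniv rfl (R_zero _ _ _ (R_rev e _ _ h))
    · exact fun q q' h => huniv rfl (R_zero _ _ _ h)
  choose τ hτ₁ hτ₂ using @hext
  -- An orientation of the graph makes the bijections along `e` and `e⁻¹` inverse to each other.
  have hne : ∀ {u v : V} (e : u ⟶ v),
      idx ⟨u, v, e⟩ ≠ idx ⟨v, u, Quiver.reverse e⟩ := by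
    intro u v e h
    have h' := hidx h
    obtain rfl : u = v := congrArg Sigma.fst h'
    simp only [Sigma.mk.injEq, heq_eq_eq, true_and] at h'
    exact SerreGraph.reverse_ne e h'.symm
  let σ : ∀ {u v : V}, (u ⟶ v) → (ℕ → Set (A.vertexGroup u)) ≃ (ℕ → Set (A.vertexGroup v)) :=
    fun {u v} e => if idx ⟨u, v, e⟩ < idx ⟨v, u, Quiver.reverse e⟩ then τ e
      else (τ (Quiver.reverse e)).symm
  refine ⟨{ Pt := fun v => ℕ → Set (A.vertexGroup v)
            act := shift
            act_one := shift_one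
            act_mul := shift_mul
            move := fun e => σ e
            move_act := ?_
            move_reverse := ?_ }, id, fun _ => Function.injective_id, fun _ _ _ => rfl, ?_⟩
  · intro u v e p c
    dsimp only [σ]
    split_ifs with h
    · exact hτ₁ e p c
    · rw [Equiv.symm_apply_eq, ← A.α_flip, hτ₁, Equiv.apply_symm_apply, A.ω_flip]
  · intro u v e p
    dsimp only [σ]
    by_cases h : idx ⟨u, v, e⟩ < idx ⟨v, u, Quiver.reverse e⟩
    · rw [if_pos h, if_neg (by rw [Quiver.reverse_reverse]; exact h.not_gt),
        Quiver.reverse_reverse]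
      exact (τ e).symm_apply_apply p
    · have h' := lt_of_le_of_ne (not_lt.1 h) (hne e).symm
      rw [if_neg h, if_pos (by rw [Quiver.reverse_reverse]; exact h')]
      exact (τ (Quiver.reverse e)).apply_symm_apply p
  · intro u v e p q hpq
    change σ e p = q
    dsimp only [σ]
    split_ifs with h
    · exact hτ₂ e p q hpq
    · rw [Equiv.symm_apply_eq]
      exact (hτ₂ _ _ _ (R_rev e _ _ hpq)).symm

open GroupAlgorithms

variable {N : ℕ}

/-! ### Finite descriptions of partial actions -/

/-- A name of an orbit of a vertex group: a label, and generators of the stabilizer of a base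
point of the orbit. -/
abbrev OrbitName (N : ℕ) : Type := ℕ × List (Word N)

/-- A name `(s, a)` of a point: the base point of the orbit `s`, translated by `a`. -/
abbrev PointName (N : ℕ) : Type := OrbitName N × Word N

/-- A finite description of the edges of a partial action: triples `(c, e, c')`, where `e` moves
the point with name `c` to the point with name `c'`. -/
abbrev EdgeTable (V : Type u) [SerreGraph.{u, w} V] (N : ℕ) : Type max u w :=
  List (PointName N × Edge V × PointName N)

/-- The inverse edge. -/
def Edge.rev (e : Edge V) : Edge V := ⟨e.2.1, e.1, Quiver.reverse e.2.2⟩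

/-- Two names describe the same point of an orbit of a group with generating tuple `x`. -/
def SamePoint {G : Type*} [Group G] (x : Fin N → G) (c c' : PointName N) : Prop :=
  c.1 = c'.1 ∧ wordVal x (c.2 ++ FreeGroup.invRev c'.2) ∈ spanWords x c.1.2

/-- The words `a⁻¹ l a` for `l` in a list. -/
def conjList (a : Word N) (L : List (Word N)) : List (Word N) :=
  L.map fun l => FreeGroup.invRev a ++ l ++ a

lemma mem_spanWords_conjList {G : Type*} [Group G] (x : Fin N → G) (a : Word N)
    (L : List (Word N)) (g : G) :
    g ∈ spanWords x (conjList a L) ↔ wordVal x a * g * (wordVal x a)⁻¹ ∈ spanWords x L := by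
  have h := spanWords_map_map (MulAut.conj (wordVal x a)⁻¹).toMonoidHom x x
    (fun l => FreeGroup.invRev a ++ l ++ a)
    (fun l => by simp [wordVal_append, wordVal_invRev, mul_assoc]) L
  rw [conjList, h, Subgroup.mem_map]
  constructor
  · rintro ⟨b, hb, rfl⟩
    simpa [mul_assoc] using hb
  · intro hg
    exact ⟨_, hg, by simp [mul_assoc]⟩

/-- Generating tuples of a common length for the vertex and edge groups, together with the
substitutions which translate words for elements of the edge groups into words for their images
in the vertex groups, words for all elements, and the algorithms which compute the intersections
of subgroups of the vertex groups with the images of the edge groups. -/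
structure Coding (A : GraphOfGroups.{u, w, x, y} V) (N : ℕ) where
  /-- Generators of a vertex group. -/
  vgen : ∀ v : V, Fin N → A.vertexGroup v
  /-- Generators of an edge group. -/
  egen : ∀ e : Edge V, Fin N → A.edgeGroup e.2.2
  /-- A word for an element of a vertex group. -/
  vword : ∀ {v : V}, A.vertexGroup v → Word N
  vword_val : ∀ {v : V} (a : A.vertexGroup v), wordVal (vgen v) (vword a) = a
  /-- A word for an element of an edge group. -/
  eword : ∀ (e : Edge V), A.edgeGroup e.2.2 → Word N
  eword_val : ∀ (e : Edge V) (c : A.edgeGroup e.2.2), wordVal (egen e) (eword e c) = c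
  /-- Substitution of words for the images of the generators under `α`. -/
  αw : Edge V → Word N → Word N
  αw_val : ∀ e l, wordVal (vgen e.1) (αw e l) = A.α e.2.2 (wordVal (egen e) l)
  /-- Substitution of words for the images of the generators under `ω`. -/
  ωw : Edge V → Word N → Word N
  ωw_val : ∀ e l, wordVal (vgen e.2.1) (ωw e l) = A.ω e.2.2 (wordVal (egen e) l)
  /-- Generators of the intersection of a subgroup with the image of `α`. -/
  meet : Edge V → List (Word N) → List (Word N)
  meet_span : ∀ e L, spanWords (vgen e.1) (meet e L) =
    (A.α e.2.2).range ⊓ spanWords (vgen e.1) L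

namespace Coding

variable (K : Coding A N)

/-- No translate of the origin of `t` by the edge group is the origin of `t'`. -/
def Separate (t t' : PointName N × Edge V × PointName N) : Prop :=
  ∀ c ∈ (A.α t.2.1.2.2).range,
    wordVal (K.vgen t.2.1.1) (FreeGroup.invRev t.1.2 ++ t'.1.2) * c ∉
      spanWords (K.vgen t.2.1.1) (conjList t.1.2 t.1.1.2)

/-- Some element of the edge group translates both ends of `t` to the ends of `t'`. -/
def Agree (t t' : PointName N × Edge V × PointName N) : Prop :=
  ∃ l : Word N, SamePoint (K.vgen t.2.1.1) (t.1.1, t.1.2 ++ K.αw t.2.1 l) t'.1 ∧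
    SamePoint (K.vgen t.2.1.2.1) (t.2.2.1, t.2.2.2 ++ K.ωw t.2.1 l) t'.2.2

/-- The elements of the edge group which fix the origin of `t` fix its end. -/
def Balanced (t : PointName N × Edge V × PointName N) : Prop :=
  ∃ C : List (Word N),
    (∀ l ∈ K.meet t.2.1 (conjList t.1.2 t.1.1.2),
      wordVal (K.vgen t.2.1.1) l ∈ spanWords (K.vgen t.2.1.1) (C.map (K.αw t.2.1))) ∧
    ∀ l ∈ C, wordVal (K.vgen t.2.1.2.1) (K.ωw t.2.1 l) ∈
      spanWords (K.vgen t.2.1.2.1) (conjList t.2.2.2 t.2.2.1.2)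

/-- A table of edges which describes a partial action. -/
structure Valid (E : EdgeTable V N) : Prop where
  symm : ∀ t ∈ E, (t.2.2, t.2.1.rev, t.1) ∈ E
  compat : ∀ t ∈ E, ∀ t' ∈ E,
    (t.2.1 ≠ t'.2.1 ∨ t.1.1 ≠ t'.1.1) ∨ K.Separate t t' ∨ K.Agree t t'
  balanced : ∀ t ∈ E, K.Balanced t

/-- A letter of a coded path: a word for an element of a vertex group, or an edge. -/
abbrev Letter (V : Type u) [SerreGraph.{u, w} V] (N : ℕ) : Type max u w :=
  (V × Word N) ⊕ Edge V

/-- One step in the partial action described by a table. -/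
def Step (E : EdgeTable V N) (c : PointName N) : Letter V N → PointName N → Prop
  | .inl (v, l), c' => SamePoint (K.vgen v) (c.1, c.2 ++ l) c'
  | .inr e, c' => (c, e, c') ∈ E

/-- The code of an `𝔸`-path. -/
def letters : ∀ {v v' : V}, APath A v v' → List (Letter V N)
  | v, _, nil a => [.inl (v, K.vword a)]
  | v, _, cons a e p => .inl (v, K.vword a) :: .inr ⟨_, _, e⟩ :: letters p

/-! ### Tables describe subsets of actions -/

section Soundness

/-- The point `s · a`, as a sequence of subsets: the coset `⟨s⟩ a` at the position determined
by `s`, and empty sets elsewhere. -/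
def cosetSeq {G : Type*} [Group G] (x : Fin N → G) (s : OrbitName N) (a : G) : ℕ → Set G
  | 0 => ∅
  | n + 1 => {g | n = Encodable.encode s ∧ g * a⁻¹ ∈ spanWords x s.2}

lemma shift_cosetSeq {G : Type*} [Group G] (x : Fin N → G) (s : OrbitName N) (a b : G) :
    shift (cosetSeq x s a) b = cosetSeq x s (a * b) := by
  funext n
  ext g
  cases n <;> simp [shift, cosetSeq, mul_assoc]

lemma cosetSeq_eq_iff {G : Type*} [Group G] {x : Fin N → G} {s s' : OrbitName N} {a a' : G} :
    cosetSeq x s a = cosetSeq x s' a' ↔ s = s' ∧ a * a'⁻¹ ∈ spanWords x s.2 := by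
  constructor
  · intro h
    have ha : a ∈ cosetSeq x s a (Encodable.encode s + 1) := by
      simp [cosetSeq]
    rw [h] at ha
    obtain ⟨h₁, h₂⟩ := ha
    obtain rfl := Encodable.encode_injective h₁
    exact ⟨rfl, h₂⟩
  · rintro ⟨rfl, h⟩
    funext n
    ext g
    cases n with
    | zero => rfl
    | succ n =>
      refine and_congr_right fun _ => ?_
      constructor
      · intro hg
        have := Subgroup.mul_mem _ hg h
        simpa [mul_assoc] using this
      · intro hg
        have := Subgroup.mul_mem _ hg (Subgroup.inv_mem _ h)
        simpa [mul_assoc] using this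

lemma cosetSeq_eq_iff_samePoint {G : Type*} [Group G] {x : Fin N → G} {c c' : PointName N} :
    cosetSeq x c.1 (wordVal x c.2) = cosetSeq x c'.1 (wordVal x c'.2) ↔ SamePoint x c c' := by
  rw [cosetSeq_eq_iff, SamePoint, wordVal_append, wordVal_invRev]

variable {K}

/-- In a valid table, the end of a translate of an edge is determined by its origin. -/
lemma Valid.determined {E : EdgeTable V N} (hE : K.Valid E) {e : Edge V}
    {s₁ s₂ : OrbitName N} {a₁ a₂ : Word N} {c₁ c₂ : PointName N}
    (h₁ : ((s₁, a₁), e, c₁) ∈ E) (h₂ : ((s₂, a₂), e, c₂) ∈ E) (k : A.edgeGroup e.2.2)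
    (hs : s₁ = s₂) (hk : wordVal (K.vgen e.1) a₁ * A.α e.2.2 k * (wordVal (K.vgen e.1) a₂)⁻¹ ∈
      spanWords (K.vgen e.1) s₁.2) :
    c₁.1 = c₂.1 ∧ wordVal (K.vgen e.2.1) c₁.2 * A.ω e.2.2 k * (wordVal (K.vgen e.2.1) c₂.2)⁻¹ ∈
      spanWords (K.vgen e.2.1) c₁.1.2 := by
  subst hs
  obtain h | h | ⟨l, ⟨-, hl₁⟩, hl₂, hl₃⟩ := hE.compat _ h₁ _ h₂
  · simp at h
  · exfalso
    refine h (A.α e.2.2 k⁻¹) ⟨_, rfl⟩ ((mem_spanWords_conjList _ _ _ _).2 ?_)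
    have := Subgroup.inv_mem _ hk
    simpa [wordVal_append, wordVal_invRev, mul_assoc] using this
  · refine ⟨hl₂, ?_⟩
    simp only [wordVal_append, wordVal_invRev, K.αw_val, K.ωw_val] at hl₁ hl₃
    obtain ⟨C, hC₁, hC₂⟩ := hE.balanced _ h₁
    dsimp only at hC₁ hC₂
    set k₀ := wordVal (K.egen e) l with hk₀
    have hfix : A.α e.2.2 (k * k₀⁻¹) ∈ spanWords (K.vgen e.1) (conjList a₁ s₁.2) := by
      rw [mem_spanWords_conjList]
      have := Subgroup.mul_mem _ hk (Subgroup.inv_mem _ hl₁)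
      simpa [mul_assoc] using this
    have hmeet : A.α e.2.2 (k * k₀⁻¹) ∈
        spanWords (K.vgen e.1) (K.meet e (conjList a₁ s₁.2)) := by
      rw [K.meet_span]
      exact ⟨⟨_, rfl⟩, hfix⟩
    have hmem := (spanWords_le _).2 hC₁ hmeet
    rw [spanWords_map_map (A.α e.2.2) (K.egen e) (K.vgen e.1) (K.αw e) (K.αw_val e)] at hmem
    have hkC : k * k₀⁻¹ ∈ spanWords (K.egen e) C := by
      obtain ⟨k', hk', heq⟩ := hmem
      rwa [← A.α_injective e.2.2 heq]
    have hω : A.ω e.2.2 (k * k₀⁻¹) ∈ spanWords (K.vgen e.2.1) (conjList c₁.2 c₁.1.2) := by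
      have hle : spanWords (K.vgen e.2.1) (C.map (K.ωw e)) ≤
          spanWords (K.vgen e.2.1) (conjList c₁.2 c₁.1.2) := by
        rw [spanWords_le]
        intro l' hl'
        obtain ⟨l'', hl'', rfl⟩ := List.mem_map.1 hl'
        exact hC₂ _ hl''
      apply hle
      rw [spanWords_map_map (A.ω e.2.2) (K.egen e) (K.vgen e.2.1) (K.ωw e) (K.ωw_val e)]
      exact ⟨_, hkC, rfl⟩
    rw [mem_spanWords_conjList] at hω
    have := Subgroup.mul_mem _ hω hl₃
    simpa [mul_assoc] using this

/-- A valid table is part of an action. -/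
theorem Valid.exists_action [Countable (Edge V)] {E : EdgeTable V N} (hE : K.Valid E) :
    ∃ M : Action.{u, w, x, y, x} A, ∃ pt : ∀ v : V, PointName N → M.Pt v,
      (∀ v c c', pt v c = pt v c' ↔ SamePoint (K.vgen v) c c') ∧
      ∀ {v v' : V} (p : APath A v v') (c c' : PointName N),
        Reach (K.Step E) c (K.letters p) c' → M.pathAct (pt v c) p = pt v' c' := by
  have hcount : ∀ v, Countable (A.vertexGroup v) := fun v =>
    Function.Surjective.countable (f := wordVal (K.vgen v)) fun a => ⟨_, K.vword_val a⟩
  let R : ∀ {u v : V}, (u ⟶ v) → (ℕ → Set (A.vertexGroup u)) → (ℕ → Set (A.vertexGroup v)) →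
      Prop := fun {u v} e p q => ∃ (c c' : PointName N) (k : A.edgeGroup e),
    (c, (⟨u, v, e⟩ : Edge V), c') ∈ E ∧
      p = cosetSeq (K.vgen u) c.1 (wordVal (K.vgen u) c.2 * A.α e k) ∧
      q = cosetSeq (K.vgen v) c'.1 (wordVal (K.vgen v) c'.2 * A.ω e k)
  have R_fun : ∀ {u v : V} (e : u ⟶ v) p q q', R e p q → R e p q' → q = q' := by
    rintro u v e p q q' ⟨c₁, c₁', k₁, h₁, rfl, rfl⟩ ⟨c₂, c₂', k₂, h₂, hp, rfl⟩
    rw [cosetSeq_eq_iff] at hp ⊢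
    have := hE.determined h₁ h₂ (k₁ * k₂⁻¹) hp.1 (by simpa [mul_assoc] using hp.2)
    exact ⟨this.1, by simpa [mul_assoc] using this.2⟩
  have R_rev : ∀ {u v : V} (e : u ⟶ v) p q, R e p q → R (Quiver.reverse e) q p := by
    rintro u v e p q ⟨c, c', k, h, rfl, rfl⟩
    exact ⟨c', c, A.flip e k, hE.symm _ h, by rw [A.α_flip], by rw [A.ω_flip]⟩
  have R_act : ∀ {u v : V} (e : u ⟶ v) p q (c : A.edgeGroup e), R e p q →
      R e (shift p (A.α e c)) (shift q (A.ω e c)) := by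
    rintro u v e p q k ⟨c, c', k', h, rfl, rfl⟩
    exact ⟨c, c', k' * k, h, by rw [shift_cosetSeq, map_mul, mul_assoc],
      by rw [shift_cosetSeq, map_mul, mul_assoc]⟩
  have R_zero : ∀ {u v : V} (e : u ⟶ v) p q, R e p q → p 0 = ∅ := by
    rintro u v e p q ⟨c, c', k, h, rfl, rfl⟩
    rfl
  obtain ⟨M, pt, pt_inj, pt_shift, pt_move⟩ :=
    exists_action_extension (A := A) R R_fun R_rev R_act R_zero
  refine ⟨M, fun v c => pt (cosetSeq (K.vgen v) c.1 (wordVal (K.vgen v) c.2)), ?_, ?_⟩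
  · intro v c c'
    rw [(pt_inj v).eq_iff, cosetSeq_eq_iff_samePoint]
  · have hword : ∀ {v : V} (a : A.vertexGroup v) (c d : PointName N),
        K.Step E c (.inl (v, K.vword a)) d →
        M.act (pt (cosetSeq (K.vgen v) c.1 (wordVal (K.vgen v) c.2))) a =
          pt (cosetSeq (K.vgen v) d.1 (wordVal (K.vgen v) d.2)) := by
      intro v a c d h
      have h' := cosetSeq_eq_iff_samePoint.2 h
      rw [← h', ← pt_shift, shift_cosetSeq, wordVal_append, K.vword_val]
    intro v v' p
    induction p with
    | nil a =>
      rintro c c' ⟨d, hd, rfl⟩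
      exact hword a c d hd
    | @cons u v v' a e p ih =>
      rintro c c' ⟨d, hd, d', hd', hr⟩
      rw [← ih d' c' hr, Action.pathAct, hword a c d hd, pt_move e _ _ ⟨d, d', 1, hd', ?_, rfl⟩]
      · simp
      · simp

end Soundness

end Coding

end GraphOfGroups

/-- In a group with the ascending chain condition on subgroups, every subgroup is generated by a
finite set. -/
lemma Subgroup.exists_finite_closure_eq {G : Type*} [Group G] [WellFoundedGT (Subgroup G)]
    (H : Subgroup G) : ∃ S : Set G, S.Finite ∧ Subgroup.closure S = H := by
  obtain ⟨M, ⟨S, hS, hSH, rfl⟩, hmax⟩ := (wellFounded_gt (α := Subgroup G)).has_min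
    {M | ∃ S : Set G, S.Finite ∧ S ⊆ H ∧ Subgroup.closure S = M}
    ⟨_, ∅, Set.finite_empty, Set.empty_subset _, rfl⟩
  refine ⟨S, hS, le_antisymm ((Subgroup.closure_le H).2 hSH) fun h hh => ?_⟩
  have h₁ := hmax (Subgroup.closure (insert h S))
    ⟨insert h S, hS.insert h, Set.insert_subset hh hSH, rfl⟩
  have h₂ : Subgroup.closure S ≤ Subgroup.closure (insert h S) :=
    Subgroup.closure_mono (Set.subset_insert _ _)
  by_contra hn
  refine h₁ (lt_of_le_of_ne h₂ fun heq => hn ?_)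
  rw [heq]
  exact Subgroup.subset_closure (Set.mem_insert _ _)

namespace GraphOfGroups

open APath GroupAlgorithms

variable {V : Type u} [SerreGraph.{u, w} V] {A : GraphOfGroups.{u, w, x, y} V} {N : ℕ}

/-! ### Finite parts of actions are described by tables -/

namespace Action

variable (M : Action.{u, w, x, y, z} A)

lemma act_inv_act {v : V} (p : M.Pt v) (a : A.vertexGroup v) : M.act (M.act p a) a⁻¹ = p := by
  rw [← M.act_mul, mul_inv_cancel, M.act_one]

/-- The stabilizer of a point in a vertex group. -/
def vertexStab {v : V} (p : M.Pt v) : Subgroup (A.vertexGroup v) where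
  carrier := {a | M.act p a = p}
  one_mem' := M.act_one p
  mul_mem' {a b} ha hb := by
    simp only [Set.mem_ofPred_eq] at *
    rw [M.act_mul, ha, hb]
  inv_mem' {a} ha := by
    simp only [Set.mem_ofPred_eq] at *
    conv_lhs => rw [← ha]
    exact M.act_inv_act p a

lemma mem_vertexStab {v : V} {p : M.Pt v} {a : A.vertexGroup v} :
    a ∈ M.vertexStab p ↔ M.act p a = p := Iff.rfl

/-- Two points of the same orbit of a vertex group. -/
def orbitSetoid (v : V) : Setoid (M.Pt v) where
  r p q := ∃ a, M.act p a = q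
  iseqv := ⟨fun p => ⟨1, M.act_one p⟩,
    fun {p q} ⟨a, h⟩ => ⟨a⁻¹, by rw [← h, M.act_inv_act]⟩,
    fun {p q r} ⟨a, h⟩ ⟨b, h'⟩ => ⟨a * b, by rw [M.act_mul, h, h']⟩⟩

/-- The base point of the orbit of a point. -/
noncomputable def base {v : V} (p : M.Pt v) : M.Pt v :=
  (Quotient.mk (M.orbitSetoid v) p).out

lemma exists_act_base {v : V} (p : M.Pt v) : ∃ a, M.act (M.base p) a = p :=
  Quotient.exact (s := M.orbitSetoid v) (Quotient.out_eq (Quotient.mk (M.orbitSetoid v) p))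

/-- An element of the vertex group which takes the base point of its orbit to a point. -/
noncomputable def coord {v : V} (p : M.Pt v) : A.vertexGroup v := (M.exists_act_base p).choose

lemma act_coord {v : V} (p : M.Pt v) : M.act (M.base p) (M.coord p) = p :=
  (M.exists_act_base p).choose_spec

lemma base_act {v : V} (p : M.Pt v) (a : A.vertexGroup v) : M.base (M.act p a) = M.base p := by
  unfold base
  congr 1
  exact Quotient.sound (s := M.orbitSetoid v) ⟨a⁻¹, M.act_inv_act p a⟩

/-- The element of the stabilizer of the base point which measures the difference between the
coordinates of `p · a` and the coordinates of `p` times `a`. -/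
noncomputable def defect {v : V} (p : M.Pt v) (a : A.vertexGroup v) : A.vertexGroup v :=
  M.coord p * a * (M.coord (M.act p a))⁻¹

lemma defect_mem {v : V} (p : M.Pt v) (a : A.vertexGroup v) :
    M.defect p a ∈ M.vertexStab (M.base p) := by
  rw [mem_vertexStab, defect, M.act_mul, M.act_mul, M.act_coord]
  conv_rhs => rw [← M.base_act p a, ← M.act_inv_act (M.base (M.act p a)) (M.coord (M.act p a)),
    M.act_coord]

/-- The applications of elements of vertex groups along a path. -/
def vertexTrace : ∀ {v v' : V}, M.Pt v → APath A v v' → Set (Σ v : V, M.Pt v × A.vertexGroup v)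
  | v, _, p, nil a => {⟨v, p, a⟩}
  | v, _, p, cons a e q => insert ⟨v, p, a⟩ (vertexTrace (M.move e (M.act p a)) q)

/-- The edges traversed along a path. -/
def edgeTrace : ∀ {v v' : V}, M.Pt v → APath A v v' → Set (Σ e : Edge V, M.Pt e.1)
  | _, _, _, nil _ => ∅
  | _, _, p, cons a e q => insert ⟨⟨_, _, e⟩, M.act p a⟩ (edgeTrace (M.move e (M.act p a)) q)

lemma finite_vertexTrace {v v' : V} (p : M.Pt v) (q : APath A v v') :
    (M.vertexTrace p q).Finite := by
  induction q with
  | nil a => exact Set.finite_singleton _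
  | cons a e q ih => exact (ih _).insert _

lemma finite_edgeTrace {v v' : V} (p : M.Pt v) (q : APath A v v') :
    (M.edgeTrace p q).Finite := by
  induction q with
  | nil a => exact Set.finite_empty
  | cons a e q ih => exact (ih _).insert _

/-- The traversal of an edge in the opposite direction. -/
def revEdge (d : Σ e : Edge V, M.Pt e.1) : Σ e : Edge V, M.Pt e.1 :=
  ⟨d.1.rev, M.move d.1.2.2 d.2⟩

lemma revEdge_revEdge (d : Σ e : Edge V, M.Pt e.1) : M.revEdge (M.revEdge d) = d := by
  obtain ⟨⟨u, v, e⟩, p⟩ := d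
  simp only [revEdge, Edge.rev]
  rw [M.move_reverse, Quiver.reverse_reverse]

/-- Names for all points of an action, in which the base points of the orbits are labelled
injectively by `label` and carry the lists `L` as generators of (a subgroup of) their
stabilizers. -/
noncomputable def name (K : Coding A N) (label : ∀ v, M.Pt v → ℕ)
    (L : ∀ v, M.Pt v → List (Word N)) {v : V} (p : M.Pt v) : PointName N :=
  ((label v (M.base p), L v (M.base p)), K.vword (M.coord p))

section Name

variable {M} {K : Coding A N} {label : ∀ v, M.Pt v → ℕ} {L : ∀ v, M.Pt v → List (Word N)}

lemma samePoint_name_iff {v : V} {p q : M.Pt v} :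
    SamePoint (K.vgen v) (M.name K label L p) (M.name K label L q) ↔
      (label v (M.base p), L v (M.base p)) = (label v (M.base q), L v (M.base q)) ∧
        M.coord p * (M.coord q)⁻¹ ∈ spanWords (K.vgen v) (L v (M.base p)) := by
  simp [SamePoint, name, wordVal_append, wordVal_invRev, K.vword_val]

lemma eq_of_act_eq (hlabel : ∀ v, Function.Injective (label v))
    (hL : ∀ v r, spanWords (K.vgen v) (L v r) ≤ M.vertexStab r) {v : V} {p q : M.Pt v}
    {c : A.vertexGroup v}
    (h₁ : (label v (M.base p), L v (M.base p)) = (label v (M.base q), L v (M.base q)))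
    (h₂ : M.coord p * c * (M.coord q)⁻¹ ∈ spanWords (K.vgen v) (L v (M.base p))) :
    M.act p c = q := by
  have hb : M.base p = M.base q := hlabel v (congrArg Prod.fst h₁)
  have h := (M.mem_vertexStab).1 (hL v _ h₂)
  rw [M.act_mul, M.act_mul, M.act_coord] at h
  have h' := congrArg (fun r => M.act r (M.coord q)) h
  rw [← M.act_mul, inv_mul_cancel, M.act_one, hb, M.act_coord] at h'
  exact h'

end Name

/-- Choice of generators for subgroups of the stabilizers of the base points: finitely many given
elements of the stabilizers suffice. -/
lemma exists_generators (K : Coding A N) {T : Set (Σ v : V, M.Pt v × A.vertexGroup v)}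
    (hT : T.Finite) : ∃ L : ∀ v, M.Pt v → List (Word N),
      (∀ v r, spanWords (K.vgen v) (L v r) ≤ M.vertexStab r) ∧
      ∀ v p a, (⟨v, p, a⟩ : Σ v : V, M.Pt v × A.vertexGroup v) ∈ T →
        M.defect p a ∈ spanWords (K.vgen v) (L v (M.base p)) := by
  have hex : ∀ (v : V) (r : M.Pt v), ∃ L : List (Word N), ∀ l, l ∈ L ↔
      l ∈ (fun t : M.Pt v × A.vertexGroup v => K.vword (M.defect t.1 t.2)) ''
        ((fun t => (⟨v, t⟩ : Σ v : V, M.Pt v × A.vertexGroup v)) ⁻¹' T ∩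
          {t | M.base t.1 = r}) := by
    intro v r
    have hfin := ((hT.preimage sigma_mk_injective.injOn).inter_of_left
      {t | M.base t.1 = r}).image (fun t : M.Pt v × A.vertexGroup v => K.vword (M.defect t.1 t.2))
    exact ⟨hfin.toFinset.toList, fun l => by simp⟩
  choose L hL using hex
  refine ⟨L, fun v r => ?_, fun v p a h => ?_⟩
  · rw [spanWords_le]
    intro l hl
    obtain ⟨⟨p, a⟩, ⟨-, hr⟩, rfl⟩ := (hL v r l).1 hl
    rw [K.vword_val]
    obtain rfl : M.base p = r := hr
    exact M.defect_mem p a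
  · have := wordVal_mem_spanWords (K.vgen v) ((hL v (M.base p) _).2 ⟨(p, a), ⟨h, rfl⟩, rfl⟩)
    rwa [K.vword_val] at this

/-- Finitely many paths in an action of a graph of groups with Noetherian edge groups are read in a
valid table, whose names of points in the action are faithful. The stabilizers of the base
points of the orbits may be replaced by finitely generated subgroups, as long as these contain
the stabilizers in the edge groups of the finitely many edges in the table. -/
theorem exists_table [∀ v, Countable (M.Pt v)] (K : Coding A N)
    (hN : ∀ {u v : V} (e : u ⟶ v), WellFoundedGT (Subgroup (A.edgeGroup e))) {v₀ : V}
    {Q : Set (M.Pt v₀ × APath A v₀ v₀)} (hQ : Q.Finite) :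
    ∃ E : EdgeTable V N, K.Valid E ∧ ∃ nm : M.Pt v₀ → PointName N,
      (∀ p q, SamePoint (K.vgen v₀) (nm p) (nm q) ↔ p = q) ∧
      ∀ t ∈ Q, Reach (K.Step E) (nm t.1) (K.letters t.2) (nm (M.pathAct t.1 t.2)) := by
  classical
  -- The traversals of edges in the table, closed under inversion.
  let D₀ : Set (Σ e : Edge V, M.Pt e.1) := ⋃ t ∈ Q, M.edgeTrace t.1 t.2
  have hD₀ : D₀.Finite := hQ.biUnion fun t _ => M.finite_edgeTrace _ _
  let D : Set (Σ e : Edge V, M.Pt e.1) := D₀ ∪ M.revEdge '' D₀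
  have hD : D.Finite := hD₀.union (hD₀.image _)
  have hDrev : ∀ d ∈ D, M.revEdge d ∈ D := by
    rintro d (hd | ⟨d, hd, rfl⟩)
    · exact .inr ⟨d, hd, rfl⟩
    · rw [M.revEdge_revEdge]
      exact .inl hd
  -- Finite generating sets of the stabilizers in the edge groups.
  have hstab : ∀ d : Σ e : Edge V, M.Pt e.1, ∃ S : Set (A.edgeGroup d.1.2.2), S.Finite ∧
      Subgroup.closure S = (M.vertexStab d.2).comap (A.α d.1.2.2) := fun d =>
    haveI := hN d.1.2.2
    Subgroup.exists_finite_closure_eq _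
  choose S hSfin hS using hstab
  -- Elements of edge groups which translate one traversal to another.
  have htrans : ∀ d d' : Σ e : Edge V, M.Pt e.1, ∃ c : A.edgeGroup d.1.2.2,
      ∀ c' : A.edgeGroup d.1.2.2,
        (⟨d.1, M.act d.2 (A.α d.1.2.2 c')⟩ : Σ e : Edge V, M.Pt e.1) = d' →
        (⟨d.1, M.act d.2 (A.α d.1.2.2 c)⟩ : Σ e : Edge V, M.Pt e.1) = d' := by
    intro d d'
    by_cases h : ∃ c' : A.edgeGroup d.1.2.2,
        (⟨d.1, M.act d.2 (A.α d.1.2.2 c')⟩ : Σ e : Edge V, M.Pt e.1) = d'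
    · exact ⟨h.choose, fun _ _ => h.choose_spec⟩
    · push Not at h
      exact ⟨1, fun c' hc' => (h c' hc').elim⟩
  choose tr htr using htrans
  let T : Set (Σ v : V, M.Pt v × A.vertexGroup v) :=
    (⋃ t ∈ Q, M.vertexTrace t.1 t.2) ∪
    ((⋃ d ∈ D, (fun c => ⟨d.1.2.1, M.move d.1.2.2 d.2, A.ω d.1.2.2 c⟩) '' S d) ∪
    ((⋃ d ∈ D, (fun d' => ⟨d.1.1, d.2, A.α d.1.2.2 (tr d d')⟩) '' D) ∪
    (⋃ d ∈ D, (fun d' => ⟨d.1.2.1, M.move d.1.2.2 d.2, A.ω d.1.2.2 (tr d d')⟩) '' D)))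
  have hT : T.Finite :=
    (hQ.biUnion fun t _ => M.finite_vertexTrace _ _).union
      ((hD.biUnion fun d _ => (hSfin d).image _).union
        ((hD.biUnion fun d _ => hD.image _).union (hD.biUnion fun d _ => hD.image _)))
  have hT₁ : ∀ t ∈ Q, M.vertexTrace t.1 t.2 ⊆ T := fun t ht =>
    (Set.subset_biUnion_of_mem (u := fun t : M.Pt v₀ × APath A v₀ v₀ => M.vertexTrace t.1 t.2)
      ht).trans Set.subset_union_left
  have hT₂ : ∀ d ∈ D, ∀ c ∈ S d, (⟨d.1.2.1, M.move d.1.2.2 d.2, A.ω d.1.2.2 c⟩ :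
      Σ v : V, M.Pt v × A.vertexGroup v) ∈ T := fun d hd c hc =>
    .inr (.inl (Set.mem_biUnion hd ⟨c, hc, rfl⟩))
  have hT₃ : ∀ d ∈ D, ∀ d' ∈ D, (⟨d.1.1, d.2, A.α d.1.2.2 (tr d d')⟩ :
      Σ v : V, M.Pt v × A.vertexGroup v) ∈ T := fun d hd d' hd' =>
    .inr (.inr (.inl (Set.mem_biUnion hd ⟨d', hd', rfl⟩)))
  have hT₄ : ∀ d ∈ D, ∀ d' ∈ D,
      (⟨d.1.2.1, M.move d.1.2.2 d.2, A.ω d.1.2.2 (tr d d')⟩ :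
        Σ v : V, M.Pt v × A.vertexGroup v) ∈ T := fun d hd d' hd' =>
    .inr (.inr (.inr (Set.mem_biUnion hd ⟨d', hd', rfl⟩)))
  obtain ⟨L, hL, hLT⟩ := M.exists_generators K hT
  choose label hlabel using fun v => Countable.exists_injective_nat (M.Pt v)
  let nm : ∀ {v : V}, M.Pt v → PointName N := fun {v} p => M.name K label L p
  -- Applications of group elements which are recorded in `T` are visible in the names.
  have hact : ∀ {v : V} (p : M.Pt v) (a : A.vertexGroup v) (l : Word N),
      wordVal (K.vgen v) l = a → (⟨v, p, a⟩ : Σ v : V, M.Pt v × A.vertexGroup v) ∈ T →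
      SamePoint (K.vgen v) ((nm p).1, (nm p).2 ++ l) (nm (M.act p a)) := by
    rintro v p a l rfl h
    have h' := hLT v p _ h
    refine ⟨?_, ?_⟩
    · simp only [nm, name, M.base_act]
    · simpa [nm, name, wordVal_append, wordVal_invRev, K.vword_val, defect, mul_assoc] using h'
  let entry : (Σ e : Edge V, M.Pt e.1) → PointName N × Edge V × PointName N := fun d =>
    (nm d.2, d.1, nm (M.move d.1.2.2 d.2))
  let E : EdgeTable V N := hD.toFinset.toList.map entry
  have hE : ∀ t, t ∈ E ↔ ∃ d ∈ D, entry d = t := fun t => by simp [E]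
  refine ⟨E, ⟨?_, ?_, ?_⟩, nm, ?_, ?_⟩
  · intro t ht
    obtain ⟨d, hd, rfl⟩ := (hE t).1 ht
    refine (hE _).2 ⟨_, hDrev d hd, ?_⟩
    simp only [entry, revEdge, Edge.rev]
    rw [M.move_reverse]
  · intro t ht t' ht'
    obtain ⟨d, hd, rfl⟩ := (hE t).1 ht
    obtain ⟨d', hd', rfl⟩ := (hE t').1 ht'
    by_cases hc : ∃ c' : A.edgeGroup d.1.2.2,
        (⟨d.1, M.act d.2 (A.α d.1.2.2 c')⟩ : Σ e : Edge V, M.Pt e.1) = d'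
    · obtain ⟨c', hc'⟩ := hc
      have h := htr d d' c' hc'
      refine .inr (.inr ⟨K.eword d.1 (tr d d'), ?_, ?_⟩)
      · have := hact d.2 _ (K.αw d.1 (K.eword d.1 (tr d d')))
          (by rw [K.αw_val, K.eword_val]) (hT₃ d hd d' hd')
        have hn : nm (M.act d.2 (A.α d.1.2.2 (tr d d'))) = nm d'.2 :=
          congrArg (fun f : Σ e : Edge V, M.Pt e.1 => nm f.2) h
        rw [hn] at this
        exact this
      · have := hact (M.move d.1.2.2 d.2) _ (K.ωw d.1 (K.eword d.1 (tr d d')))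
          (by rw [K.ωw_val, K.eword_val]) (hT₄ d hd d' hd')
        have hn : nm (M.move d.1.2.2 (M.act d.2 (A.α d.1.2.2 (tr d d')))) =
            nm (M.move d'.1.2.2 d'.2) :=
          congrArg (fun f : Σ e : Edge V, M.Pt e.1 => nm (M.move f.1.2.2 f.2)) h
        rw [← M.move_act, hn] at this
        exact this
    · by_cases hne : d.1 ≠ d'.1 ∨ (nm d.2).1 ≠ (nm d'.2).1
      · exact .inl hne
      · push Not at hne
        obtain ⟨e, p⟩ := d
        obtain ⟨e', p'⟩ := d'
        obtain ⟨rfl, hs⟩ := hne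
        refine .inr (.inl ?_)
        rintro _ ⟨c, rfl⟩ hmem
        refine hc ⟨c⁻¹, ?_⟩
        rw [mem_spanWords_conjList] at hmem
        simp only [entry, nm, name, wordVal_append, wordVal_invRev, K.vword_val] at hmem hs
        have hp : M.act p' (A.α e.2.2 c) = p := eq_of_act_eq hlabel hL hs.symm (by
          rw [← (Prod.mk.inj hs).2]
          simpa [mul_assoc] using hmem)
        rw [← hp, map_inv, M.act_inv_act]
  · intro t ht
    obtain ⟨d, hd, rfl⟩ := (hE t).1 ht
    have hfin := (hSfin d).image (K.eword d.1)
    refine ⟨hfin.toFinset.toList, ?_, ?_⟩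
    · intro l hl
      have hmem := wordVal_mem_spanWords (K.vgen d.1.1) hl
      simp only [entry] at hmem ⊢
      rw [K.meet_span] at hmem
      obtain ⟨⟨c, hc⟩, hmem⟩ := Subgroup.mem_inf.1 hmem
      rw [← hc, mem_spanWords_conjList] at hmem
      have hp : M.act d.2 (A.α d.1.2.2 c) = d.2 := eq_of_act_eq hlabel hL rfl (by
        simpa [nm, name, K.vword_val] using hmem)
      have hcS : c ∈ Subgroup.closure (S d) := by
        rw [hS]
        exact hp
      rw [← hc, spanWords_map_map (A.α d.1.2.2) (K.egen d.1) _ _ (K.αw_val d.1)]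
      refine ⟨c, ?_, rfl⟩
      refine (Subgroup.closure_le _).2 (fun s hs => ?_) hcS
      have := wordVal_mem_spanWords (K.egen d.1) (X := hfin.toFinset.toList)
        (l := K.eword d.1 s) (by simpa using ⟨s, hs, rfl⟩)
      rwa [K.eword_val] at this
    · intro l hl
      obtain ⟨c, hc, rfl⟩ : ∃ c ∈ S d, K.eword d.1 c = l := by simpa using hl
      simp only [entry]
      rw [mem_spanWords_conjList, K.ωw_val, K.eword_val]
      have hfix : M.act (M.move d.1.2.2 d.2) (A.ω d.1.2.2 c) = M.move d.1.2.2 d.2 := by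
        rw [← M.move_act]
        congr 1
        have : c ∈ (M.vertexStab d.2).comap (A.α d.1.2.2) := by
          rw [← hS]
          exact Subgroup.subset_closure hc
        exact this
      have := hLT _ _ _ (hT₂ d hd c hc)
      rw [defect, hfix] at this
      simpa [nm, name, K.vword_val] using this
  · intro p q
    constructor
    · intro h
      obtain ⟨h₁, h₂⟩ := samePoint_name_iff.1 h
      have := eq_of_act_eq (c := 1) hlabel hL h₁ (by simpa using h₂)
      rwa [M.act_one] at this
    · rintro rfl
      exact samePoint_name_iff.2 ⟨rfl, by simp⟩
  · have hread : ∀ {v v' : V} (q : APath A v v') (p : M.Pt v), M.vertexTrace p q ⊆ T →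
        M.edgeTrace p q ⊆ D → Reach (K.Step E) (nm p) (K.letters q) (nm (M.pathAct p q)) := by
      intro v v' q
      induction q with
      | @nil v a =>
        intro p hp _
        exact ⟨_, hact p a _ (K.vword_val a) (hp rfl), rfl⟩
      | @cons u v v' a e q ih =>
        intro p hp hp'
        rw [vertexTrace, Set.insert_subset_iff] at hp
        rw [edgeTrace, Set.insert_subset_iff] at hp'
        exact ⟨_, hact p a _ (K.vword_val a) hp.1, _, (hE _).2 ⟨_, hp'.1, rfl⟩, ih _ hp.2 hp'.2⟩
    intro t ht
    refine hread t.2 t.1 (hT₁ t ht) ?_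
    exact (Set.subset_biUnion_of_mem
      (u := fun t : M.Pt v₀ × APath A v₀ v₀ => M.edgeTrace t.1 t.2) ht).trans
      Set.subset_union_left

end Action

/-! ### Validity of tables is recursively enumerable -/

namespace Coding

/-- The data of a coding are computable, membership in the vertex groups is decidable, and
separation of cosets of the edge groups can be verified. -/
structure Effective (K : Coding A N) : Prop where
  mem : ∀ v, MembershipDecidable (K.vgen v)
  αw : ∀ e, Primrec (K.αw e)
  ωw : ∀ e, Primrec (K.ωw e)
  meet : ∀ e, Computable (K.meet e)
  separate : ∀ e : Edge V, REPred fun p : List (Word N) × Word N =>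
    ∀ c ∈ (A.α e.2.2).range, wordVal (K.vgen e.1) p.2 * c ∉ spanWords (K.vgen e.1) p.1

lemma primrec_append_invRev {N : ℕ} :
    Primrec fun p : Word N × Word N => p.1 ++ FreeGroup.invRev p.2 :=
  Primrec.list_append.comp Primrec.fst (primrec_invRev.comp Primrec.snd)

lemma primrec_conjList {N : ℕ} :
    Primrec fun p : Word N × List (Word N) => conjList p.1 p.2 := by
  have h₁ : Primrec fun q : (Word N × List (Word N)) × Word N => FreeGroup.invRev q.1.1 ++ q.2 :=
    Primrec.list_append.comp (primrec_invRev.comp (Primrec.fst.comp Primrec.fst)) Primrec.snd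
  have h₂ : Primrec fun q : (Word N × List (Word N)) × Word N =>
      FreeGroup.invRev q.1.1 ++ q.2 ++ q.1.1 :=
    Primrec.list_append.comp h₁ (Primrec.fst.comp Primrec.fst)
  exact Primrec.list_map Primrec.snd h₂.to₂

variable {K : Coding A N}

lemma Effective.mem_re (hK : K.Effective) {α : Type*} [Primcodable α] (v : V)
    {f : α → List (Word N)}
    {g : α → Word N} (hf : Computable f) (hg : Computable g) :
    REPred fun a => wordVal (K.vgen v) (g a) ∈ spanWords (K.vgen v) (f a) := by
  have h := (hK.mem v).to_re.comp (hf.pair hg)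
  exact h

lemma Effective.notMem_re (hK : K.Effective) {α : Type*} [Primcodable α] (v : V)
    {f : α → List (Word N)}
    {g : α → Word N} (hf : Computable f) (hg : Computable g) :
    REPred fun a => wordVal (K.vgen v) (g a) ∉ spanWords (K.vgen v) (f a) := by
  have h := (hK.mem v).not.to_re.comp (hf.pair hg)
  exact h

lemma Effective.samePoint_re (hK : K.Effective) {α : Type*} [Primcodable α] (v : V)
    {f g : α → PointName N}
    (hf : Computable f) (hg : Computable g) :
    REPred fun a => SamePoint (K.vgen v) (f a) (g a) := by
  have h₁ := REPred.eq (Computable.fst.comp hf) (Computable.fst.comp hg)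
  have h₂ : Computable fun a => (f a).2 ++ FreeGroup.invRev (g a).2 :=
    primrec_append_invRev.to_comp.comp ((Computable.snd.comp hf).pair (Computable.snd.comp hg))
  exact h₁.and (hK.mem_re v (Computable.snd.comp (Computable.fst.comp hf)) h₂)

lemma Effective.not_samePoint_re (hK : K.Effective) {α : Type*} [Primcodable α] (v : V)
    {f g : α → PointName N}
    (hf : Computable f) (hg : Computable g) :
    REPred fun a => ¬ SamePoint (K.vgen v) (f a) (g a) := by
  have h₁ := REPred.ne (Computable.fst.comp hf) (Computable.fst.comp hg)
  have h₂ : Computable fun a => (f a).2 ++ FreeGroup.invRev (g a).2 :=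
    primrec_append_invRev.to_comp.comp ((Computable.snd.comp hf).pair (Computable.snd.comp hg))
  have h₃ := hK.notMem_re v (Computable.snd.comp (Computable.fst.comp hf)) h₂
  refine (h₁.or h₃).of_eq fun a => ?_
  rw [SamePoint, not_and_or]

variable [Primcodable (Edge V)]

section

variable [Finite (Edge V)]

lemma Effective.separate_re (hK : K.Effective) :
    REPred fun p : (PointName N × Edge V × PointName N) ×
    (PointName N × Edge V × PointName N) => K.Separate p.1 p.2 := by
  have key : ∀ e : Edge V, REPred fun p : PointName N × PointName N =>
      ∀ c ∈ (A.α e.2.2).range, wordVal (K.vgen e.1) (FreeGroup.invRev p.1.2 ++ p.2.2) * c ∉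
        spanWords (K.vgen e.1) (conjList p.1.2 p.1.1.2) := by
    intro e
    have h₁ : Primrec fun p : PointName N × PointName N => conjList p.1.2 p.1.1.2 :=
      primrec_conjList.comp ((Primrec.snd.comp Primrec.fst).pair
        (Primrec.snd.comp (Primrec.fst.comp Primrec.fst)))
    have h₂ : Primrec fun p : PointName N × PointName N => FreeGroup.invRev p.1.2 ++ p.2.2 :=
      Primrec.list_append.comp (primrec_invRev.comp (Primrec.snd.comp Primrec.fst))
        (Primrec.snd.comp Primrec.snd)
    have h := (hK.separate e).comp (h₁.pair h₂).to_comp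
    exact h
  have hf : Computable fun p : (PointName N × Edge V × PointName N) ×
      (PointName N × Edge V × PointName N) => (p.1.2.1, (p.1.1, p.2.1)) :=
    (Computable.fst.comp (Computable.snd.comp Computable.fst)).pair
      ((Computable.fst.comp Computable.fst).pair (Computable.fst.comp Computable.snd))
  have h := (REPred.finite_index key).comp hf
  exact h

lemma Effective.agree_re (hK : K.Effective) : REPred fun p : (PointName N × Edge V × PointName N) ×
    (PointName N × Edge V × PointName N) => K.Agree p.1 p.2 := by
  let Y := (PointName N × PointName N) × (PointName N × PointName N)
  have key : ∀ e : Edge V, REPred fun p : Y => ∃ l : Word N,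
      SamePoint (K.vgen e.1) (p.1.1.1, p.1.1.2 ++ K.αw e l) p.2.1 ∧
      SamePoint (K.vgen e.2.1) (p.1.2.1, p.1.2.2 ++ K.ωw e l) p.2.2 := by
    intro e
    have h₁ : Computable fun q : Y × Word N => q.1.1.1 :=
      Computable.fst.comp (Computable.fst.comp Computable.fst)
    have h₂ : Computable fun q : Y × Word N => q.1.1.2 :=
      Computable.snd.comp (Computable.fst.comp Computable.fst)
    have h₃ : Computable fun q : Y × Word N => q.1.2.1 :=
      Computable.fst.comp (Computable.snd.comp Computable.fst)
    have h₄ : Computable fun q : Y × Word N => q.1.2.2 :=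
      Computable.snd.comp (Computable.snd.comp Computable.fst)
    have h₅ : Computable fun q : Y × Word N =>
        ((q.1.1.1.1, q.1.1.1.2 ++ K.αw e q.2) : PointName N) :=
      (Computable.fst.comp h₁).pair (Computable.list_append.comp (Computable.snd.comp h₁)
        ((hK.αw e).to_comp.comp Computable.snd))
    have h₆ : Computable fun q : Y × Word N =>
        ((q.1.1.2.1, q.1.1.2.2 ++ K.ωw e q.2) : PointName N) :=
      (Computable.fst.comp h₂).pair (Computable.list_append.comp (Computable.snd.comp h₂)
        ((hK.ωw e).to_comp.comp Computable.snd))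
    have h := (hK.samePoint_re e.1 h₅ h₃).and (hK.samePoint_re e.2.1 h₆ h₄)
    exact REPred.exists_snd h
  have hf : Computable fun p : (PointName N × Edge V × PointName N) ×
      (PointName N × Edge V × PointName N) =>
        (p.1.2.1, ((p.1.1, p.1.2.2), (p.2.1, p.2.2.2))) :=
    (Computable.fst.comp (Computable.snd.comp Computable.fst)).pair
      (((Computable.fst.comp Computable.fst).pair
        (Computable.snd.comp (Computable.snd.comp Computable.fst))).pair
      ((Computable.fst.comp Computable.snd).pair
        (Computable.snd.comp (Computable.snd.comp Computable.snd))))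
  have h := (REPred.finite_index key).comp hf
  exact h

lemma Effective.balanced_re (hK : K.Effective) :
    REPred fun t : PointName N × Edge V × PointName N => K.Balanced t := by
  let Y := PointName N × PointName N
  have key : ∀ e : Edge V, REPred fun p : Y => ∃ C : List (Word N),
      (∀ l ∈ K.meet e (conjList p.1.2 p.1.1.2),
        wordVal (K.vgen e.1) l ∈ spanWords (K.vgen e.1) (C.map (K.αw e))) ∧
      ∀ l ∈ C, wordVal (K.vgen e.2.1) (K.ωw e l) ∈
        spanWords (K.vgen e.2.1) (conjList p.2.2 p.2.1.2) := by
    intro e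
    have hc : Primrec fun c : PointName N => conjList c.2 c.1.2 :=
      primrec_conjList.comp (Primrec.snd.pair (Primrec.snd.comp Primrec.fst))
    have h₁ : Primrec fun q : Y × List (Word N) => conjList q.1.1.2 q.1.1.1.2 :=
      hc.comp (Primrec.fst.comp Primrec.fst)
    have h₂ : Primrec fun q : Y × List (Word N) => conjList q.1.2.2 q.1.2.1.2 :=
      hc.comp (Primrec.snd.comp Primrec.fst)
    have h₃ : Primrec fun q : (Y × List (Word N)) × Word N => q.1.2 :=
      Primrec.snd.comp Primrec.fst
    have h₄ : REPred fun q : (Y × List (Word N)) × Word N => wordVal (K.vgen e.1) q.2 ∈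
        spanWords (K.vgen e.1) (q.1.2.map (K.αw e)) := by
      have h := Primrec.list_map h₃ ((hK.αw e).comp Primrec.snd).to₂
      exact hK.mem_re e.1 h.to_comp Computable.snd
    have h₅ : REPred fun q : (Y × List (Word N)) × Word N =>
        wordVal (K.vgen e.2.1) (K.ωw e q.2) ∈
          spanWords (K.vgen e.2.1) (conjList q.1.1.2.2 q.1.1.2.1.2) := by
      have h := h₂.to_comp.comp (Computable.fst (α := Y × List (Word N)) (β := Word N))
      exact hK.mem_re e.2.1 h ((hK.ωw e).to_comp.comp Computable.snd)
    have h₆ : Computable fun q : Y × List (Word N) => K.meet e (conjList q.1.1.2 q.1.1.1.2) :=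
      (hK.meet e).comp h₁.to_comp
    have h₇ : REPred fun q : Y × List (Word N) =>
        ∀ l ∈ K.meet e (conjList q.1.1.2 q.1.1.1.2),
          wordVal (K.vgen e.1) l ∈ spanWords (K.vgen e.1) (q.2.map (K.αw e)) :=
      REPred.forall_mem (p := fun (q : Y × List (Word N)) (l : Word N) =>
        wordVal (K.vgen e.1) l ∈ spanWords (K.vgen e.1) (q.2.map (K.αw e))) h₄ h₆
    have h₈ : REPred fun q : Y × List (Word N) =>
        ∀ l ∈ q.2, wordVal (K.vgen e.2.1) (K.ωw e l) ∈
          spanWords (K.vgen e.2.1) (conjList q.1.2.2 q.1.2.1.2) :=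
      REPred.forall_mem (p := fun (q : Y × List (Word N)) (l : Word N) =>
        wordVal (K.vgen e.2.1) (K.ωw e l) ∈
          spanWords (K.vgen e.2.1) (conjList q.1.2.2 q.1.2.1.2)) h₅ Computable.snd
    have h₉ := h₇.and h₈
    exact REPred.exists_snd (p := fun (p : Y) (C : List (Word N)) =>
      (∀ l ∈ K.meet e (conjList p.1.2 p.1.1.2),
        wordVal (K.vgen e.1) l ∈ spanWords (K.vgen e.1) (C.map (K.αw e))) ∧
      ∀ l ∈ C, wordVal (K.vgen e.2.1) (K.ωw e l) ∈
        spanWords (K.vgen e.2.1) (conjList p.2.2 p.2.1.2)) h₉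
  have hf : Computable fun t : PointName N × Edge V × PointName N => (t.2.1, (t.1, t.2.2)) :=
    (Computable.fst.comp Computable.snd).pair
      (Computable.fst.pair (Computable.snd.comp Computable.snd))
  have h := (REPred.finite_index key).comp hf
  exact h

lemma Effective.valid_re (hK : K.Effective) : REPred fun E : EdgeTable V N => K.Valid E := by
  let T := PointName N × Edge V × PointName N
  have h₁ : REPred fun E : EdgeTable V N => ∀ t ∈ E, (t.2.2, t.2.1.rev, t.1) ∈ E := by
    have hf : Computable fun q : EdgeTable V N × T => (q.2.2.2, q.2.2.1.rev, q.2.1) :=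
      (Computable.snd.comp (Computable.snd.comp Computable.snd)).pair
        (((Primrec.dom_finite Edge.rev).to_comp.comp
          (Computable.fst.comp (Computable.snd.comp Computable.snd))).pair
        (Computable.fst.comp Computable.snd))
    have h : REPred fun q : EdgeTable V N × T => (q.2.2.2, q.2.2.1.rev, q.2.1) ∈ q.1 :=
      REPred.mem_list hf Computable.fst
    exact REPred.forall_mem (p := fun (E : EdgeTable V N) (t : T) => (t.2.2, t.2.1.rev, t.1) ∈ E)
      h Computable.id
  have h₂ : REPred fun E : EdgeTable V N => ∀ t ∈ E, ∀ t' ∈ E,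
      (t.2.1 ≠ t'.2.1 ∨ t.1.1 ≠ t'.1.1) ∨ K.Separate t t' ∨ K.Agree t t' := by
    let Y := (EdgeTable V N × T) × T
    have ht : Computable fun q : Y => q.1.2 := Computable.snd.comp Computable.fst
    have ht' : Computable fun q : Y => q.2 := Computable.snd
    have h₁ := REPred.ne (Computable.fst.comp (Computable.snd.comp ht))
      (Computable.fst.comp (Computable.snd.comp ht'))
    have h₂ := REPred.ne (Computable.fst.comp (Computable.fst.comp ht))
      (Computable.fst.comp (Computable.fst.comp ht'))
    have h₃ := hK.separate_re.comp (ht.pair ht')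
    have h₄ := hK.agree_re.comp (ht.pair ht')
    have hp : REPred fun q : Y => (q.1.2.2.1 ≠ q.2.2.1 ∨ q.1.2.1.1 ≠ q.2.1.1) ∨
        K.Separate q.1.2 q.2 ∨ K.Agree q.1.2 q.2 := (h₁.or h₂).or (h₃.or h₄)
    have hp' : REPred fun q : EdgeTable V N × T => ∀ t' ∈ q.1,
        (q.2.2.1 ≠ t'.2.1 ∨ q.2.1.1 ≠ t'.1.1) ∨ K.Separate q.2 t' ∨ K.Agree q.2 t' :=
      REPred.forall_mem (p := fun (q : EdgeTable V N × T) (t' : T) =>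
        (q.2.2.1 ≠ t'.2.1 ∨ q.2.1.1 ≠ t'.1.1) ∨ K.Separate q.2 t' ∨ K.Agree q.2 t')
        hp Computable.fst
    exact REPred.forall_mem hp' Computable.id
  have h₃ : REPred fun E : EdgeTable V N => ∀ t ∈ E, K.Balanced t := by
    have hb : REPred fun q : EdgeTable V N × T => K.Balanced q.2 := by
      have h := hK.balanced_re.comp (Computable.snd (α := EdgeTable V N) (β := T))
      exact h
    exact REPred.forall_mem hb Computable.id
  exact (h₁.and (h₂.and h₃)).of_eq fun E =>
    ⟨fun h => ⟨h.1, h.2.1, h.2.2⟩, fun h => ⟨h.symm, h.compat, h.balanced⟩⟩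

end

variable [Primcodable V] [Finite V]

lemma Effective.step_re (hK : K.Effective) :
    REPred fun q : EdgeTable V N × PointName N × Letter V N × PointName N =>
    K.Step q.1 q.2.1 q.2.2.1 q.2.2.2 := by
  let Y := EdgeTable V N × PointName N × Letter V N × PointName N
  have hc : Computable fun q : Y => q.2.1 := Computable.fst.comp Computable.snd
  have ha : Computable fun q : Y => q.2.2.1 :=
    Computable.fst.comp (Computable.snd.comp Computable.snd)
  have hd : Computable fun q : Y => q.2.2.2 :=
    Computable.snd.comp (Computable.snd.comp Computable.snd)
  have h₁ : REPred fun q : Y => ∃ r : V × Word N, q.2.2.1 = .inl r ∧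
      SamePoint (K.vgen r.1) (q.2.1.1, q.2.1.2 ++ r.2) q.2.2.2 := by
    have key : ∀ v : V, REPred fun s : (PointName N × Word N) × PointName N =>
        SamePoint (K.vgen v) (s.1.1.1, s.1.1.2 ++ s.1.2) s.2 := by
      intro v
      have h : Computable fun s : (PointName N × Word N) × PointName N =>
          ((s.1.1.1, s.1.1.2 ++ s.1.2) : PointName N) :=
        (Computable.fst.comp (Computable.fst.comp Computable.fst)).pair
          (Computable.list_append.comp
            (Computable.snd.comp (Computable.fst.comp Computable.fst))
            (Computable.snd.comp Computable.fst))
      exact hK.samePoint_re v h Computable.snd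
    have hf : Computable fun s : Y × (V × Word N) => (s.2.1, ((s.1.2.1, s.2.2), s.1.2.2.2)) :=
      (Computable.fst.comp Computable.snd).pair
        (((hc.comp Computable.fst).pair (Computable.snd.comp Computable.snd)).pair
          (hd.comp Computable.fst))
    have h := (REPred.finite_index key).comp hf
    have h' : REPred fun s : Y × (V × Word N) => s.1.2.2.1 = .inl s.2 :=
      REPred.eq (ha.comp Computable.fst)
        ((Primrec.sumInl (α := V × Word N) (β := Edge V)).to_comp.comp Computable.snd)
    exact REPred.exists_snd (p := fun (q : Y) (r : V × Word N) => q.2.2.1 = .inl r ∧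
      SamePoint (K.vgen r.1) (q.2.1.1, q.2.1.2 ++ r.2) q.2.2.2) (h'.and h)
  have h₂ : REPred fun q : Y => ∃ e : Edge V, q.2.2.1 = .inr e ∧ (q.2.1, e, q.2.2.2) ∈ q.1 := by
    have h' : REPred fun s : Y × Edge V => s.1.2.2.1 = .inr s.2 :=
      REPred.eq (ha.comp Computable.fst)
        ((Primrec.sumInr (α := V × Word N) (β := Edge V)).to_comp.comp Computable.snd)
    have hf : Computable fun s : Y × Edge V => (s.1.2.1, s.2, s.1.2.2.2) :=
      (hc.comp Computable.fst).pair (Computable.snd.pair (hd.comp Computable.fst))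
    have h : REPred fun s : Y × Edge V => (s.1.2.1, s.2, s.1.2.2.2) ∈ s.1.1 :=
      REPred.mem_list hf (Computable.fst.comp Computable.fst)
    exact REPred.exists_snd (p := fun (q : Y) (e : Edge V) =>
      q.2.2.1 = .inr e ∧ (q.2.1, e, q.2.2.2) ∈ q.1) (h'.and h)
  refine (h₁.or h₂).of_eq ?_
  rintro ⟨E, c, ⟨v, l⟩ | e, d⟩
  · simp [Step]
  · simp [Step]

end Coding

/-! ### Elements of the fundamental group represented by paths -/

namespace APath

lemma inv_append_self {v v' : V} (p : APath A v v') : Equivalent (p.inv.append p) (nil 1) := by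
  induction p with
  | nil a => simpa [append, inv, lmul] using Equivalent.refl _
  | @cons u v v' a e p ih =>
    have h₁ : (cons a e p).inv.append (cons a e p) =
        p.inv.append ((cons 1 (Quiver.reverse e) (cons 1 e (nil 1))).append p) := by
      rw [inv, append_assoc]
      simp only [append, one_lmul]
      simp [lmul]
    have key := Equivalent.reduce (A := A) (Quiver.reverse e) 1 1 1
    simp only [Quiver.reverse_reverse, map_one, mul_one] at key
    rw [h₁]
    have h₂ := Equivalent.append key (.refl p)
    rw [one_append] at h₂
    exact .trans (.append (.refl _) h₂) ih

end APath

section Base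

variable {v₀ : V} (t : ∀ v : V, APath A v₀ v)

/-- The element of the fundamental group represented by a path between arbitrary vertices, which
are connected to the base vertex by the paths `t`. -/
def cls {v v' : V} (p : APath A v v') : FundamentalGroup A v₀ :=
  .mk ((t v).append (p.append (t v').inv))

lemma cls_eq_of_equivalent {v v' : V} {p q : APath A v v'} (h : Equivalent p q) :
    cls t p = cls t q :=
  FundamentalGroup.mk_eq_of_equivalent (.append (.refl _) (.append h (.refl _)))

lemma cls_append {v v' v'' : V} (p : APath A v v') (q : APath A v' v'') :
    cls t (p.append q) = cls t p * cls t q := by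
  unfold cls
  rw [← FundamentalGroup.mk_append]
  refine (FundamentalGroup.mk_eq_of_equivalent ?_).symm
  have h := Equivalent.append (.refl ((t v).append p))
    (Equivalent.append (inv_append_self (t v')) (.refl (q.append (t v'').inv)))
  simpa [append_assoc, one_append] using h

lemma cls_one (v : V) : cls t (nil 1 : APath A v v) = 1 := by
  unfold cls
  rw [one_append]
  exact FundamentalGroup.mk_eq_of_equivalent (append_inv _)

/-- The homomorphism from a vertex group to the fundamental group. -/
def vertexHom (v : V) : A.vertexGroup v →* FundamentalGroup A v₀ where
  toFun a := cls t (nil a)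
  map_one' := cls_one t v
  map_mul' a b := by rw [← cls_append]; rfl

/-- The element of the fundamental group represented by an edge. -/
def edgeElt {u v : V} (e : u ⟶ v) : FundamentalGroup A v₀ := cls t (cons 1 e (nil 1))

lemma cls_nil {v : V} (a : A.vertexGroup v) : cls t (nil a) = vertexHom t v a := rfl

lemma cls_cons {u v v' : V} (a : A.vertexGroup u) (e : u ⟶ v) (p : APath A v v') :
    cls t (cons a e p) = vertexHom t u a * edgeElt t e * cls t p := by
  rw [← cls_nil, edgeElt, ← cls_append, ← cls_append]
  change _ = cls t (cons (a * 1) e (lmul 1 p))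
  rw [mul_one, one_lmul]

lemma edge_relation {u v : V} (e : u ⟶ v) (c : A.edgeGroup e) :
    edgeElt t e * vertexHom t v (A.ω e c) * edgeElt t (Quiver.reverse e) =
      vertexHom t u (A.α e c) := by
  have h := cls_eq_of_equivalent t (Equivalent.reduce (A := A) e c 1 1)
  rw [cls_cons, cls_cons, cls_nil, cls_nil] at h
  simpa [mul_assoc] using h

lemma edgeElt_reverse {u v : V} (e : u ⟶ v) :
    edgeElt t (Quiver.reverse e) = (edgeElt (A := A) t e)⁻¹ := by
  have h := edge_relation (A := A) t e 1
  simp only [map_one, mul_one] at h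
  exact (inv_eq_of_mul_eq_one_right h).symm

lemma cls_closed (ht : t v₀ = nil 1) (p : APath A v₀ v₀) : cls t p = .mk p := by
  unfold cls
  rw [ht]
  simp [inv, one_append, append_one]

/-- The action of a graph of groups on the cosets of a subgroup of its fundamental group. -/
def cosetAction (H : Subgroup (FundamentalGroup A v₀)) : Action.{u, w, x, y, max u w x} A where
  Pt _ := FundamentalGroup A v₀ ⧸ H
  act {v} p a := (vertexHom t v a)⁻¹ • p
  act_one p := by simp
  act_mul p a b := by simp [mul_smul]
  move e p := (edgeElt t e)⁻¹ • p
  move_act e p c := by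
    rw [smul_smul, smul_smul, ← mul_inv_rev, ← mul_inv_rev, ← edge_relation, edgeElt_reverse]
    simp
  move_reverse e p := by
    rw [edgeElt_reverse, smul_smul]
    simp

/-- The coset of an element as a point of the action on cosets. -/
def cosetPt (H : Subgroup (FundamentalGroup A v₀)) (v : V) (g : FundamentalGroup A v₀) :
    (cosetAction t H).Pt v := (QuotientGroup.mk g : FundamentalGroup A v₀ ⧸ H)

lemma cosetAction_pathAct (H : Subgroup (FundamentalGroup A v₀)) {v v' : V} (p : APath A v v')
    (g : FundamentalGroup A v₀) :
    (cosetAction t H).pathAct (cosetPt t H v g) p = cosetPt t H v' ((cls t p)⁻¹ * g) := by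
  induction p generalizing g with
  | nil a => rfl
  | cons a e p ih =>
    rw [cls_cons, mul_inv_rev, mul_inv_rev, mul_assoc, mul_assoc, ← ih]
    rfl

lemma cosetAction_fixes_iff (ht : t v₀ = nil 1) (H : Subgroup (FundamentalGroup A v₀))
    (g : FundamentalGroup A v₀) :
    (cosetAction t H).groupAct (cosetPt t H v₀ 1) g = cosetPt t H v₀ 1 ↔ g ∈ H := by
  obtain ⟨p, rfl⟩ := FundamentalGroup.mk_surjective g
  rw [Action.groupAct_mk, cosetAction_pathAct, cls_closed t ht, mul_one, eq_comm]
  refine QuotientGroup.eq.trans ?_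
  simp

end Base

/-! ### Certificates for non-membership -/

section NotMem

variable {v₀ : V} {n : ℕ} {gen : Fin n → FundamentalGroup A v₀}
  {P : Fin n × Bool → APath A v₀ v₀}

/-- The paths read along a word, together with the points at which they start. -/
def wordTrace (M : Action.{u, w, x, y, z} A) (P : Fin n × Bool → APath A v₀ v₀) :
    M.Pt v₀ → Word n → Set (M.Pt v₀ × APath A v₀ v₀)
  | _, [] => ∅
  | p, s :: l => insert (p, P s) (wordTrace M P (M.pathAct p (P s)) l)

lemma finite_wordTrace (M : Action.{u, w, x, y, z} A) (p : M.Pt v₀) (l : Word n) :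
    (wordTrace M P p l).Finite := by
  induction l generalizing p with
  | nil => exact Set.finite_empty
  | cons s l ih => exact (ih _).insert _

lemma groupAct_wordVal_cons (hP : ∀ s, FundamentalGroup.mk (P s) = cond s.2 (gen s.1) (gen s.1)⁻¹)
    (M : Action.{u, w, x, y, z} A) (p : M.Pt v₀) (s : Fin n × Bool) (l : Word n) :
    M.groupAct p (wordVal gen (s :: l)) = M.groupAct (M.pathAct p (P s)) (wordVal gen l) := by
  have h : wordVal gen (s :: l) = cond s.2 (gen s.1) (gen s.1)⁻¹ * wordVal gen l := by
    simp [wordVal]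
  rw [h, ← hP, M.groupAct_mul, M.groupAct_mk]

/-- An element lies outside a finitely generated subgroup iff some finite table describes part of an
action in which the generators fix a point and the element does not. -/
theorem notMem_iff_exists_table [Countable (Edge V)] [Countable (FundamentalGroup A v₀)]
    (K : Coding A N)
    (hN : ∀ {u v : V} (e : u ⟶ v), WellFoundedGT (Subgroup (A.edgeGroup e)))
    {t : ∀ v : V, APath A v₀ v} (ht : t v₀ = nil 1)
    (hP : ∀ s, FundamentalGroup.mk (P s) = cond s.2 (gen s.1) (gen s.1)⁻¹)
    (X : List (Word n)) (l : Word n) :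
    wordVal gen l ∉ spanWords gen X ↔ ∃ q : EdgeTable V N × PointName N, K.Valid q.1 ∧
      (∀ k ∈ X, ∃ c, Reach (K.Step q.1) q.2 (k.flatMap fun s => K.letters (P s)) c ∧
        SamePoint (K.vgen v₀) c q.2) ∧
      ∃ c, Reach (K.Step q.1) q.2 (l.flatMap fun s => K.letters (P s)) c ∧
        ¬ SamePoint (K.vgen v₀) c q.2 := by
  constructor
  · intro hl
    let M := cosetAction t (spanWords gen X)
    have hcount : ∀ v, Countable (M.Pt v) := fun v =>
      Function.Surjective.countable (f := cosetPt t (spanWords gen X) v)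
        QuotientGroup.mk_surjective
    let p₀ : M.Pt v₀ := cosetPt t (spanWords gen X) v₀ 1
    obtain ⟨E, hE, nm, hnm, hread⟩ := M.exists_table K hN
      (Q := ⋃ k ∈ {k | k ∈ l :: X}, wordTrace M P p₀ k)
      ((List.finite_toSet (l :: X)).biUnion fun k _ => finite_wordTrace M p₀ k)
    have hword : ∀ (k : Word n) (p : M.Pt v₀),
        (∀ r ∈ wordTrace M P p k, Reach (K.Step E) (nm r.1) (K.letters r.2)
          (nm (M.pathAct r.1 r.2))) →
        Reach (K.Step E) (nm p) (k.flatMap fun s => K.letters (P s))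
          (nm (M.groupAct p (wordVal gen k))) := by
      intro k
      induction k with
      | nil =>
        intro p _
        rw [wordVal_nil, M.groupAct_one]
        rfl
      | cons s k ih =>
        intro p h
        rw [wordTrace, Set.forall_mem_insert] at h
        rw [List.flatMap_cons, groupAct_wordVal_cons hP]
        exact h.1.append (ih _ h.2)
    have hword' : ∀ k ∈ l :: X, Reach (K.Step E) (nm p₀) (k.flatMap fun s => K.letters (P s))
        (nm (M.groupAct p₀ (wordVal gen k))) := fun k hk =>
      hword k p₀ fun r hr => hread r (Set.mem_biUnion hk hr)
    refine ⟨(E, nm p₀), hE, fun k hk => ⟨_, hword' k (List.mem_cons_of_mem _ hk), ?_⟩,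
      ⟨_, hword' l List.mem_cons_self, ?_⟩⟩
    · rw [hnm]
      exact (cosetAction_fixes_iff t ht _ _).2 (wordVal_mem_spanWords gen hk)
    · rw [hnm]
      exact fun h => hl ((cosetAction_fixes_iff t ht _ _).1 h)
  · rintro ⟨⟨E, c₀⟩, hE, hX, c, hc, hne⟩ hl
    obtain ⟨M, pt, hpt, hread⟩ := hE.exists_action
    have hword : ∀ (k : Word n) (c c' : PointName N),
        Reach (K.Step E) c (k.flatMap fun s => K.letters (P s)) c' →
        M.groupAct (pt v₀ c) (wordVal gen k) = pt v₀ c' := by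
      intro k
      induction k with
      | nil =>
        rintro c c' rfl
        rw [wordVal_nil, M.groupAct_one]
      | cons s k ih =>
        intro c c' h
        rw [List.flatMap_cons] at h
        obtain ⟨d, hd, hd'⟩ := h.exists_of_append
        rw [groupAct_wordVal_cons hP, hread _ _ _ hd, ih _ _ hd']
    have hle : spanWords gen X ≤ M.stabilizer (pt v₀ c₀) := by
      rw [spanWords_le]
      intro k hk
      obtain ⟨d, hd, hd'⟩ := hX k hk
      rw [M.mem_stabilizer, hword k _ _ hd]
      exact (hpt _ _ _).2 hd'
    have hfix := M.mem_stabilizer.1 (hle hl)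
    rw [hword l _ _ hc] at hfix
    exact hne ((hpt _ _ _).1 hfix)

/-- Non-membership in finitely generated subgroups of the fundamental group is recursively
enumerable. -/
theorem notMem_re [Primcodable V] [Finite V] [Primcodable (Edge V)] [Finite (Edge V)]
    [Countable (FundamentalGroup A v₀)] {K : Coding A N} (hK : K.Effective)
    (hN : ∀ {u v : V} (e : u ⟶ v), WellFoundedGT (Subgroup (A.edgeGroup e)))
    {t : ∀ v : V, APath A v₀ v} (ht : t v₀ = nil 1) (gen : Fin n → FundamentalGroup A v₀) :
    REPred fun p : List (Word n) × Word n => wordVal gen p.2 ∉ spanWords gen p.1 := by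
  choose P hP using fun s : Fin n × Bool =>
    FundamentalGroup.mk_surjective (cond s.2 (gen s.1) (gen s.1)⁻¹)
  let code : Word n → List (Coding.Letter V N) := fun l => l.flatMap fun s => K.letters (P s)
  have pcode : Primrec code := Primrec.list_flatMap Primrec.id
    ((Primrec.dom_finite fun s => K.letters (P s)).comp Primrec.snd).to₂
  let Y := List (Word n) × Word n
  let T := EdgeTable V N × PointName N
  have hreach : REPred fun q : EdgeTable V N × PointName N × List (Coding.Letter V N) ×
      PointName N => Reach (K.Step q.1) q.2.1 q.2.2.1 q.2.2.2 := reach_re hK.step_re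
  have hr : REPred fun q : (T × Word n) × PointName N =>
      Reach (K.Step q.1.1.1) q.1.1.2 (code q.1.2) q.2 := by
    have hf : Computable fun q : (T × Word n) × PointName N =>
        (q.1.1.1, q.1.1.2, code q.1.2, q.2) :=
      (Computable.fst.comp (Computable.fst.comp Computable.fst)).pair
        ((Computable.snd.comp (Computable.fst.comp Computable.fst)).pair
          ((pcode.to_comp.comp (Computable.snd.comp Computable.fst)).pair Computable.snd))
    have h := hreach.comp hf
    exact h
  have hc : Computable fun q : (T × Word n) × PointName N => q.1.1.2 :=
    Computable.snd.comp (Computable.fst.comp Computable.fst)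
  have hpos : REPred fun q : T × Word n => ∃ c, Reach (K.Step q.1.1) q.1.2 (code q.2) c ∧
      SamePoint (K.vgen v₀) c q.1.2 :=
    REPred.exists_snd (p := fun (q : T × Word n) c => Reach (K.Step q.1.1) q.1.2 (code q.2) c ∧
      SamePoint (K.vgen v₀) c q.1.2) (hr.and (hK.samePoint_re v₀ Computable.snd hc))
  have hneg : REPred fun q : T × Word n => ∃ c, Reach (K.Step q.1.1) q.1.2 (code q.2) c ∧
      ¬ SamePoint (K.vgen v₀) c q.1.2 :=
    REPred.exists_snd (p := fun (q : T × Word n) c => Reach (K.Step q.1.1) q.1.2 (code q.2) c ∧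
      ¬ SamePoint (K.vgen v₀) c q.1.2) (hr.and (hK.not_samePoint_re v₀ Computable.snd hc))
  have h₁ : REPred fun q : Y × T => K.Valid q.2.1 := by
    have h := hK.valid_re.comp (f := fun q : Y × T => q.2.1) (Computable.fst.comp Computable.snd)
    exact h
  have h₂ : REPred fun q : Y × T => ∀ k ∈ q.1.1, ∃ c,
      Reach (K.Step q.2.1) q.2.2 (code k) c ∧ SamePoint (K.vgen v₀) c q.2.2 := by
    have h := hpos.comp (f := fun q : (Y × T) × Word n => (q.1.2, q.2))
      ((Computable.snd.comp Computable.fst).pair Computable.snd)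
    exact REPred.forall_mem (p := fun (q : Y × T) (k : Word n) => ∃ c,
      Reach (K.Step q.2.1) q.2.2 (code k) c ∧ SamePoint (K.vgen v₀) c q.2.2) h
      (Computable.fst.comp Computable.fst)
  have h₃ : REPred fun q : Y × T => ∃ c,
      Reach (K.Step q.2.1) q.2.2 (code q.1.2) c ∧ ¬ SamePoint (K.vgen v₀) c q.2.2 := by
    have h := hneg.comp (f := fun q : Y × T => (q.2, q.1.2))
      (Computable.snd.pair (Computable.snd.comp Computable.fst))
    exact h
  have h₄ := REPred.exists_snd (p := fun (p : Y) (q : T) => K.Valid q.1 ∧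
      (∀ k ∈ p.1, ∃ c, Reach (K.Step q.1) q.2 (code k) c ∧ SamePoint (K.vgen v₀) c q.2) ∧
      ∃ c, Reach (K.Step q.1) q.2 (code p.2) c ∧ ¬ SamePoint (K.vgen v₀) c q.2)
    (h₁.and (h₂.and h₃))
  exact h₄.of_eq fun p => (notMem_iff_exists_table K hN ht hP p.1 p.2).symm

end NotMem

/-! ### A recursive presentation of the fundamental group -/

section Presentation

variable {v₀ : V} {n : ℕ} (K : Coding A N) (t : ∀ v : V, APath A v₀ v)
  (κ : (V × Fin N) ⊕ Edge V ≃ Fin n)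

/-- Generators of the fundamental group: the generators of the vertex groups and the edges. -/
def fundGen (j : Fin n) : FundamentalGroup A v₀ :=
  Sum.elim (fun p : V × Fin N => vertexHom t p.1 (K.vgen p.1 p.2))
    (fun e : Edge V => edgeElt t e.2.2) (κ.symm j)

/-- A word in the generators of a vertex group as a word in the generators of the fundamental
group. -/
def liftWord (v : V) (l : Word N) : Word n := l.map fun s => (κ (.inl (v, s.1)), s.2)

/-- An edge as a word in the generators of the fundamental group. -/
def edgeWord (e : Edge V) : Word n := [(κ (.inr e), true)]

/-- A path as a word in the generators of the fundamental group. -/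
def pathWord : ∀ {v v' : V}, APath A v v' → Word n
  | v, _, nil a => liftWord κ v (K.vword a)
  | v, _, cons a e p => liftWord κ v (K.vword a) ++ (edgeWord κ ⟨_, _, e⟩ ++ pathWord p)

/-- The relators of the fundamental group: the relators of the vertex groups, the relators
`e ω_e(c) e⁻¹ α_e(c)⁻¹`, and the paths `t` which connect the base vertex to all vertices. -/
def Relator (r : Word n) : Prop :=
  (∃ q : V × Word N, r = liftWord κ q.1 q.2 ∧ wordVal (K.vgen q.1) q.2 = 1) ∨
  (∃ q : Edge V × Word N, r = edgeWord κ q.1 ++ (liftWord κ q.1.2.1 (K.ωw q.1 q.2) ++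
    (edgeWord κ q.1.rev ++ FreeGroup.invRev (liftWord κ q.1.1 (K.αw q.1 q.2))))) ∨
  ∃ v : V, r = pathWord K κ (t v)

variable {K κ t}

lemma wordVal_liftWord {G : Type*} [Group G] (z : Fin n → G) (v : V) (l : Word N) :
    wordVal z (liftWord κ v l) = wordVal (fun i => z (κ (.inl (v, i)))) l := by
  simp only [wordVal, liftWord, List.map_map]
  rfl

lemma wordVal_edgeWord {G : Type*} [Group G] (z : Fin n → G) (e : Edge V) :
    wordVal z (edgeWord κ e) = z (κ (.inr e)) := by
  simp [wordVal, edgeWord]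

lemma wordVal_fundGen_liftWord (v : V) (l : Word N) :
    wordVal (fundGen K t κ) (liftWord κ v l) = vertexHom t v (wordVal (K.vgen v) l) := by
  rw [wordVal_liftWord, map_wordVal]
  congr 1
  funext i
  simp [fundGen]

lemma wordVal_fundGen_edgeWord (e : Edge V) :
    wordVal (fundGen K t κ) (edgeWord κ e) = edgeElt t e.2.2 := by
  simp [wordVal_edgeWord, fundGen]

lemma wordVal_fundGen_pathWord {v v' : V} (p : APath A v v') :
    wordVal (fundGen K t κ) (pathWord K κ p) = cls t p := by
  induction p with
  | nil a => rw [pathWord, wordVal_fundGen_liftWord, K.vword_val, cls_nil]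
  | cons a e p ih =>
    rw [pathWord, wordVal_append, wordVal_append, ih, wordVal_fundGen_liftWord, K.vword_val,
      wordVal_fundGen_edgeWord, cls_cons, mul_assoc]

lemma generates_fundGen (ht : t v₀ = nil 1) : Generates (fundGen K t κ) := by
  rw [Generates, eq_top_iff]
  rintro g -
  obtain ⟨p, rfl⟩ := FundamentalGroup.mk_surjective g
  rw [← cls_closed t ht, ← wordVal_fundGen_pathWord (K := K) (κ := κ), wordVal_eq_lift,
    ← FreeGroup.range_lift_eq_closure]
  exact ⟨_, rfl⟩

lemma wordVal_relator (ht : t v₀ = nil 1) {r : Word n} (hr : Relator K t κ r) :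
    wordVal (fundGen K t κ) r = 1 := by
  obtain ⟨⟨v, l⟩, rfl, h⟩ | ⟨⟨e, l⟩, rfl⟩ | ⟨v, rfl⟩ := hr
  · rw [wordVal_fundGen_liftWord, h, map_one]
  · simp only [wordVal_append, wordVal_invRev, wordVal_fundGen_liftWord, wordVal_fundGen_edgeWord,
      K.ωw_val, K.αw_val]
    have h := edge_relation (A := A) t e.2.2 (wordVal (K.egen e) l)
    rw [← mul_assoc, ← mul_assoc, mul_inv_eq_one]
    exact h
  · rw [wordVal_fundGen_pathWord]
    have h := cls_append t (t v) (nil 1)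
    unfold cls
    rw [ht]
    refine (FundamentalGroup.mk_eq_of_equivalent ?_).trans rfl
    rw [one_append]
    exact append_inv _

section UniversalProperty

variable {Γ : Type*} [Group Γ] {z : Fin n → Γ}

lemma wordVal_liftWord_congr
    (hz : ∀ r, Relator K t κ r → wordVal z r = 1)
    {v : V} {l l' : Word N}
    (h : wordVal (K.vgen v) l = wordVal (K.vgen v) l') :
    wordVal z (liftWord κ v l) = wordVal z (liftWord κ v l') := by
  have h₁ := hz _ (.inl ⟨(v, l ++ FreeGroup.invRev l'), rfl, by
    rw [wordVal_append, wordVal_invRev, h, mul_inv_cancel]⟩)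
  rw [wordVal_liftWord, wordVal_append, wordVal_invRev, mul_inv_eq_one] at h₁
  rwa [wordVal_liftWord, wordVal_liftWord]

lemma wordVal_pathWord_lmul
    (hz : ∀ r, Relator K t κ r → wordVal z r = 1)
    {v v' : V} (a : A.vertexGroup v) (p : APath A v v') :
    wordVal z (pathWord K κ (lmul a p)) =
      wordVal z (liftWord κ v (K.vword a)) * wordVal z (pathWord K κ p) := by
  have h : ∀ b : A.vertexGroup v, wordVal z (liftWord κ v (K.vword (a * b))) =
      wordVal z (liftWord κ v (K.vword a)) * wordVal z (liftWord κ v (K.vword b)) := by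
    intro b
    rw [wordVal_liftWord_congr hz (l' := K.vword a ++ K.vword b)
      (by rw [wordVal_append, K.vword_val, K.vword_val, K.vword_val])]
    simp only [wordVal_liftWord, wordVal_append]
  cases p with
  | nil b => exact h b
  | cons b e p =>
    rw [lmul, pathWord, pathWord, wordVal_append, h, mul_assoc, ← wordVal_append]

lemma wordVal_pathWord_append
    (hz : ∀ r, Relator K t κ r → wordVal z r = 1)
    {v v' v'' : V} (p : APath A v v') (q : APath A v' v'') :
    wordVal z (pathWord K κ (p.append q)) =
      wordVal z (pathWord K κ p) * wordVal z (pathWord K κ q) := by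
  induction p with
  | nil a => exact wordVal_pathWord_lmul hz a q
  | cons a e p ih =>
    rw [append, pathWord, pathWord, wordVal_append, wordVal_append, ih, wordVal_append,
      wordVal_append, mul_assoc, mul_assoc]

lemma wordVal_pathWord_eq_of_equivalent
    (hz : ∀ r, Relator K t κ r → wordVal z r = 1)
    {v v' : V} {p q : APath A v v'} (h : Equivalent p q) :
    wordVal z (pathWord K κ p) = wordVal z (pathWord K κ q) := by
  induction h with
  | @reduce u v e c a a' =>
    have h₁ := hz _ (.inr (.inl ⟨(⟨u, v, e⟩, K.eword ⟨u, v, e⟩ c), rfl⟩))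
    simp only [wordVal_append, wordVal_invRev] at h₁
    have hω : wordVal (K.vgen v) (K.ωw ⟨u, v, e⟩ (K.eword ⟨u, v, e⟩ c)) =
        wordVal (K.vgen v) (K.vword (A.ω e c)) :=
      (K.ωw_val ⟨u, v, e⟩ _).trans (by rw [K.eword_val, K.vword_val])
    have hα : wordVal (K.vgen u) (K.αw ⟨u, v, e⟩ (K.eword ⟨u, v, e⟩ c)) =
        wordVal (K.vgen u) (K.vword (A.α e c)) :=
      (K.αw_val ⟨u, v, e⟩ _).trans (by rw [K.eword_val, K.vword_val])
    rw [← mul_assoc, ← mul_assoc, mul_inv_eq_one, wordVal_liftWord_congr hz hω,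
      wordVal_liftWord_congr hz hα] at h₁
    have h₂ := wordVal_pathWord_lmul hz a (nil (A.α e c * a'))
    have h₃ := wordVal_pathWord_lmul hz (A.α e c) (nil a')
    simp only [lmul, pathWord, ← mul_assoc] at h₂ h₃
    simp only [pathWord, wordVal_append]
    rw [h₂, h₃, ← h₁]
    simp only [Edge.rev, mul_assoc]
  | refl p => rfl
  | symm _ ih => exact ih.symm
  | trans _ _ ih₁ ih₂ => exact ih₁.trans ih₂
  | append _ _ ih₁ ih₂ =>
    rw [wordVal_pathWord_append hz, wordVal_pathWord_append hz, ih₁, ih₂]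

lemma wordVal_pathWord_cls
    (hz : ∀ r, Relator K t κ r → wordVal z r = 1)
    {v v' : V} (p : APath A v v') :
    wordVal z (pathWord K κ ((t v).append (p.append (t v').inv))) =
      wordVal z (pathWord K κ p) := by
  have hone : ∀ v, wordVal z (pathWord K κ (nil 1 : APath A v v)) = 1 := by
    intro v
    have h := wordVal_pathWord_append hz (nil 1 : APath A v v) (nil 1)
    rw [one_append] at h
    exact left_eq_mul.1 h
  have ht : ∀ v, wordVal z (pathWord K κ (t v)) = 1 := fun v => hz _ (.inr (.inr ⟨v, rfl⟩))
  have ht' : ∀ v, wordVal z (pathWord K κ (t v).inv) = 1 := by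
    intro v
    have h := wordVal_pathWord_eq_of_equivalent hz (append_inv (t v))
    rwa [wordVal_pathWord_append hz, hone, ht, one_mul] at h
  rw [wordVal_pathWord_append hz, wordVal_pathWord_append hz, ht, ht', one_mul, mul_one]

/-- The relators present the fundamental group: every assignment of the generators which
satisfies the relators satisfies all relations. -/
theorem wordVal_eq_one_of_relators
    (hz : ∀ r, Relator K t κ r → wordVal z r = 1)
    {l : Word n} (hl : wordVal (fundGen K t κ) l = 1) :
    wordVal z l = 1 := by
  let Φ : FundamentalGroup A v₀ →* Γ := MonoidHom.mk'
    (fun g => Quotient.lift (s := APath.setoid v₀ v₀) (fun p => wordVal z (pathWord K κ p))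
      (fun _ _ h => wordVal_pathWord_eq_of_equivalent hz h) g)
    (by
      rintro ⟨p⟩ ⟨q⟩
      exact wordVal_pathWord_append hz p q)
  have hcls : ∀ {v v' : V} (p : APath A v v'), Φ (cls t p) = wordVal z (pathWord K κ p) :=
    fun p => wordVal_pathWord_cls hz p
  have hone : ∀ v : V, wordVal z (liftWord κ v (K.vword (1 : A.vertexGroup v))) = 1 := by
    intro v
    rw [wordVal_liftWord_congr hz (l' := []) (by rw [K.vword_val, wordVal_nil])]
    exact wordVal_nil z
  have hgen : ∀ j, Φ (fundGen K t κ j) = z j := by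
    intro j
    obtain ⟨⟨v, i⟩ | e, rfl⟩ := κ.surjective j
    · have h : fundGen K t κ (κ (.inl (v, i))) = cls t (nil (K.vgen v i)) := by
        simp [fundGen, cls_nil]
      rw [h, hcls, pathWord, wordVal_liftWord_congr hz (l' := [(i, true)])
        (by rw [K.vword_val]; simp [wordVal]), wordVal_liftWord]
      simp [wordVal]
    · have h : fundGen K t κ (κ (.inr e)) = cls t (cons 1 e.2.2 (nil 1)) := by
        simp [fundGen, edgeElt]
      rw [h, hcls, pathWord, pathWord, wordVal_append, wordVal_append, hone, hone,
        wordVal_edgeWord, one_mul, mul_one]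
  have h := congrArg Φ hl
  rw [map_wordVal, map_one] at h
  simpa only [hgen] using h

end UniversalProperty

/-- Membership in terms of the free group: the full preimage of a subgroup is generated by
preimages of its generators and the conjugates of the relators. -/
theorem mem_spanWords_iff_mk_mem (ht : t v₀ = nil 1) (X : List (Word n)) (l : Word n) :
    wordVal (fundGen K t κ) l ∈ spanWords (fundGen K t κ) X ↔
      FreeGroup.mk l ∈ Subgroup.closure {g | ∃ w, (w ∈ X ∨ ∃ q : Word n × Word n,
        Relator K t κ q.2 ∧ w = q.1 ++ (q.2 ++ FreeGroup.invRev q.1)) ∧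
        FreeGroup.mk w = g} := by
  set gen : Fin n → FundamentalGroup A v₀ := fundGen K t κ with hgen
  set C := Subgroup.closure {g | ∃ w, (w ∈ X ∨ ∃ q : Word n × Word n,
        Relator K t κ q.2 ∧ w = q.1 ++ (q.2 ++ FreeGroup.invRev q.1)) ∧
        FreeGroup.mk w = g} with hC
  constructor
  · intro h
    let R : Set (FreeGroup (Fin n)) := {g | ∃ r, Relator K t κ r ∧ FreeGroup.mk r = g}
    have hR : Subgroup.normalClosure R ≤ C := by
      rw [Subgroup.normalClosure, Subgroup.closure_le]
      intro g hg
      obtain ⟨_, ⟨r, hr, rfl⟩, hc⟩ := Group.mem_conjugatesOfSet_iff.1 hg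
      obtain ⟨c, rfl⟩ := isConj_iff.1 hc
      refine Subgroup.subset_closure ⟨c.toWord ++ (r ++ FreeGroup.invRev c.toWord),
        .inr ⟨(c.toWord, r), hr, rfl⟩, ?_⟩
      rw [← FreeGroup.mul_mk, ← FreeGroup.mul_mk, ← FreeGroup.inv_mk, FreeGroup.mk_toWord,
        mul_assoc]
    have hX : spanWords gen X ≤ C.map (FreeGroup.lift gen) := by
      rw [spanWords_le]
      intro k hk
      exact ⟨_, Subgroup.subset_closure ⟨k, .inl hk, rfl⟩, (wordVal_eq_lift gen k).symm⟩
    obtain ⟨g, hg, hgl⟩ := hX h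
    let z : Fin n → FreeGroup (Fin n) ⧸ Subgroup.normalClosure R :=
      fun i => QuotientGroup.mk' _ (FreeGroup.of i)
    have hzval : ∀ w : Word n, wordVal z w =
        QuotientGroup.mk' (Subgroup.normalClosure R) (FreeGroup.mk w) := by
      intro w
      have h₁ : FreeGroup.mk w = wordVal FreeGroup.of w := by
        rw [wordVal_eq_lift, FreeGroup.lift_of_eq_id]
        rfl
      rw [h₁, map_wordVal]
    have hz : ∀ r, Relator K t κ r → wordVal z r = 1 := by
      intro r hr
      rw [hzval]
      exact (QuotientGroup.eq_one_iff _).2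
        (Subgroup.subset_normalClosure ⟨r, hr, rfl⟩)
    have hquot : wordVal gen (l ++ FreeGroup.invRev g.toWord) = 1 := by
      rw [wordVal_append, wordVal_invRev, mul_inv_eq_one, wordVal_eq_lift gen g.toWord,
        FreeGroup.mk_toWord, hgl]
    have hN := wordVal_eq_one_of_relators hz hquot
    rw [hzval] at hN
    have hN' := hR ((QuotientGroup.eq_one_iff _).1 hN)
    rw [← FreeGroup.mul_mk, ← FreeGroup.inv_mk, FreeGroup.mk_toWord] at hN'
    simpa using C.mul_mem hN' hg
  · intro h
    have hle : C ≤ (spanWords gen X).comap (FreeGroup.lift gen) := by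
      rw [hC, Subgroup.closure_le]
      rintro _ ⟨w, hw | ⟨⟨c, r⟩, hr, rfl⟩, rfl⟩
      · change FreeGroup.lift gen _ ∈ spanWords gen X
        rw [← wordVal_eq_lift]
        exact wordVal_mem_spanWords gen hw
      · change FreeGroup.lift gen _ ∈ spanWords gen X
        rw [← wordVal_eq_lift, wordVal_append, wordVal_append, wordVal_invRev,
          wordVal_relator ht hr, one_mul, mul_inv_cancel]
        exact Subgroup.one_mem _
    have h' := hle h
    rw [Subgroup.mem_comap, ← wordVal_eq_lift] at h'
    exact h'

lemma primrec_liftWord [Primcodable V] [Finite V] :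
    Primrec fun q : V × Word N => liftWord κ q.1 q.2 := by
  have h : Primrec fun q : (V × Word N) × (Fin N × Bool) => (κ (.inl (q.1.1, q.2.1)), q.2.2) :=
    ((Primrec.dom_finite fun p : V × Fin N => κ (.inl p)).comp
      ((Primrec.fst.comp Primrec.fst).pair (Primrec.fst.comp Primrec.snd))).pair
      (Primrec.snd.comp Primrec.snd)
  exact Primrec.list_map Primrec.snd h.to₂

variable [Primcodable V] [Finite V] [Primcodable (Edge V)] [Finite (Edge V)]

lemma relator_re (hK : K.Effective) : REPred fun r : Word n => Relator K t κ r := by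
  have h₁ : REPred fun r : Word n => ∃ q : V × Word N, r = liftWord κ q.1 q.2 ∧
      wordVal (K.vgen q.1) q.2 = 1 := by
    have key : ∀ v : V, REPred fun l : Word N => wordVal (K.vgen v) l = 1 := by
      intro v
      refine (hK.mem_re v (Computable.const []) Computable.id).of_eq fun l => ?_
      simp [spanWords]
    have hp := (REPred.finite_index key).comp
      (Computable.snd (α := Word n) (β := V × Word N))
    have hq : REPred fun q : Word n × (V × Word N) => q.1 = liftWord κ q.2.1 q.2.2 :=
      REPred.eq Computable.fst (primrec_liftWord.to_comp.comp Computable.snd)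
    exact REPred.exists_snd (p := fun (r : Word n) (q : V × Word N) =>
      r = liftWord κ q.1 q.2 ∧ wordVal (K.vgen q.1) q.2 = 1) (hq.and hp)
  have h₂ : REPred fun r : Word n => ∃ q : Edge V × Word N, r = edgeWord κ q.1 ++
      (liftWord κ q.1.2.1 (K.ωw q.1 q.2) ++
        (edgeWord κ q.1.rev ++ FreeGroup.invRev (liftWord κ q.1.1 (K.αw q.1 q.2)))) := by
    have key : ∀ e : Edge V, REPred fun q : Word n × Word N => q.1 = edgeWord κ e ++
        (liftWord κ e.2.1 (K.ωw e q.2) ++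
          (edgeWord κ e.rev ++ FreeGroup.invRev (liftWord κ e.1 (K.αw e q.2)))) := by
      intro e
      have hω : Primrec fun q : Word n × Word N => liftWord κ e.2.1 (K.ωw e q.2) :=
        primrec_liftWord.comp ((Primrec.const e.2.1).pair ((hK.ωw e).comp Primrec.snd))
      have hα : Primrec fun q : Word n × Word N => liftWord κ e.1 (K.αw e q.2) :=
        primrec_liftWord.comp ((Primrec.const e.1).pair ((hK.αw e).comp Primrec.snd))
      have h : Primrec fun q : Word n × Word N => edgeWord κ e ++
          (liftWord κ e.2.1 (K.ωw e q.2) ++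
            (edgeWord κ e.rev ++ FreeGroup.invRev (liftWord κ e.1 (K.αw e q.2)))) :=
        Primrec.list_append.comp (Primrec.const (edgeWord κ e))
          (Primrec.list_append.comp hω (Primrec.list_append.comp
            (Primrec.const (edgeWord κ e.rev)) (primrec_invRev.comp hα)))
      exact REPred.eq Computable.fst h.to_comp
    have hp := (REPred.finite_index key).comp
      (f := fun q : Word n × (Edge V × Word N) => (q.2.1, (q.1, q.2.2)))
      ((Computable.fst.comp Computable.snd).pair
        (Computable.fst.pair (Computable.snd.comp Computable.snd)))
    exact REPred.exists_snd (p := fun (r : Word n) (q : Edge V × Word N) => r = edgeWord κ q.1 ++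
      (liftWord κ q.1.2.1 (K.ωw q.1 q.2) ++
        (edgeWord κ q.1.rev ++ FreeGroup.invRev (liftWord κ q.1.1 (K.αw q.1 q.2))))) hp
  have h₃ : REPred fun r : Word n => ∃ v : V, r = pathWord K κ (t v) := by
    have h : REPred fun q : Word n × V => q.1 = pathWord K κ (t q.2) :=
      REPred.eq Computable.fst
        ((Primrec.dom_finite fun v => pathWord K κ (t v)).to_comp.comp Computable.snd)
    exact REPred.exists_snd h
  exact h₁.or (h₂.or h₃)

/-- Membership in finitely generated subgroups of the fundamental group is recursively
enumerable. -/
theorem mem_re (hK : K.Effective) (ht : t v₀ = nil 1) :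
    REPred fun p : List (Word n) × Word n =>
      wordVal (fundGen K t κ) p.2 ∈ spanWords (fundGen K t κ) p.1 := by
  have h₁ : REPred fun p : List (Word n) × Word n => p.2 ∈ p.1 :=
    REPred.mem_list Computable.snd Computable.fst
  have h₂ : REPred fun p : List (Word n) × Word n => ∃ q : Word n × Word n,
      Relator K t κ q.2 ∧ p.2 = q.1 ++ (q.2 ++ FreeGroup.invRev q.1) := by
    let Y := (List (Word n) × Word n) × (Word n × Word n)
    have hr := (relator_re (t := t) (κ := κ) hK).comp (f := fun y : Y => y.2.2)
      (Computable.snd.comp Computable.snd)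
    have hc : Primrec fun y : Y => y.2.1 ++ (y.2.2 ++ FreeGroup.invRev y.2.1) :=
      Primrec.list_append.comp (Primrec.fst.comp Primrec.snd)
        (Primrec.list_append.comp (Primrec.snd.comp Primrec.snd)
          (primrec_invRev.comp (Primrec.fst.comp Primrec.snd)))
    have he : REPred fun y : Y => y.1.2 = y.2.1 ++ (y.2.2 ++ FreeGroup.invRev y.2.1) :=
      REPred.eq (Computable.snd.comp Computable.fst) hc.to_comp
    exact REPred.exists_snd (p := fun (p : List (Word n) × Word n) (q : Word n × Word n) =>
      Relator K t κ q.2 ∧ p.2 = q.1 ++ (q.2 ++ FreeGroup.invRev q.1)) (hr.and he)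
  have h := re_mk_mem_closure (p := fun (X : List (Word n)) (w : Word n) => w ∈ X ∨
    ∃ q : Word n × Word n, Relator K t κ q.2 ∧ w = q.1 ++ (q.2 ++ FreeGroup.invRev q.1)) (h₁.or h₂)
  exact h.of_eq fun p => (mem_spanWords_iff_mk_mem ht p.1 p.2).symm

end Presentation

/-! ### The membership problem -/

lemma exists_apath {u v : V} (p : Quiver.Path u v) : Nonempty (APath A u v) := by
  induction p with
  | nil => exact ⟨nil 1⟩
  | cons _ e ih =>
    obtain ⟨q⟩ := ih
    exact ⟨q.append (cons 1 e (nil 1))⟩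

/-- Benign graphs of groups whose vertex groups have solvable uniform membership problem have
effective codings. -/
theorem IsBenign.exists_effective [Finite V] [Finite (Edge V)] (hA : A.IsBenign)
    (hmem : ∀ v : V, SolvableUniformMembership (A.vertexGroup v)) :
    ∃ (N : ℕ) (K : Coding A N), K.Effective := by
  obtain ⟨N₁, h₁⟩ := exists_common_length (Γ := fun v : V => A.vertexGroup v)
    fun v => by
      obtain ⟨n, g, hg, -⟩ := hmem v
      exact ⟨n, g, hg⟩
  obtain ⟨N₂, h₂⟩ := exists_common_length (Γ := fun e : Edge V => A.edgeGroup e.2.2)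
    fun e => by
      obtain ⟨n, g, hg, -⟩ := hA.edge_membership e.2.2
      exact ⟨n, g, hg⟩
  choose vg hvg using h₁ (max N₁ N₂) (le_max_left _ _)
  choose eg heg using h₂ (max N₁ N₂) (le_max_right _ _)
  choose vword hvword using fun v => exists_word (hvg v)
  choose eword heword using fun e => exists_word (heg e)
  choose αw pα hα using fun e : Edge V =>
    exists_translation (hvg e.1) fun i => A.α e.2.2 (eg e i)
  choose ωw pω hω using fun e : Edge V =>
    exists_translation (hvg e.2.1) fun i => A.ω e.2.2 (eg e i)
  choose meet cmeet hmeet using fun e : Edge V =>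
    (hA.intersection e.2.2).exists_computable (hvg e.1)
  exact ⟨max N₁ N₂,
    { vgen := vg
      egen := eg
      vword := fun {v} => vword v
      vword_val := fun {v} => hvword v
      eword := eword
      eword_val := heword
      αw := αw
      αw_val := fun e l => by rw [hα, map_wordVal]
      ωw := ωw
      ωw_val := fun e l => by rw [hω, map_wordVal]
      meet := meet
      meet_span := hmeet },
    { mem := fun v => (hmem v).membershipDecidable _
      αw := pα
      ωw := pω
      meet := cmeet
      separate := fun e => (hA.coset_intersection e.2.2).disjoint_re (vg e.1) }⟩

end GraphOfGroups

theorem mainTheorem3 {V : Type u} [SerreGraph.{u, w} V] (A : GraphOfGroups.{u, w, x, y} V)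
    (hA : A.IsBenign)
    (hmem : ∀ v : V, GroupAlgorithms.SolvableUniformMembership (A.vertexGroup v))
    (v₀ : V) :
    GroupAlgorithms.SolvableUniformMembership (A.FundamentalGroup v₀) := by
  classical
  have := hA.finite_vertices
  have := hA.finite_edges
  have : Finite (GraphOfGroups.Edge V) := inferInstanceAs (Finite (Σ u v : V, (u ⟶ v)))
  let : Primcodable V := Primcodable.ofEquiv _ (Finite.equivFin V)
  let : Primcodable (GraphOfGroups.Edge V) :=
    Primcodable.ofEquiv _ (Finite.equivFin (GraphOfGroups.Edge V))
  obtain ⟨N, K, hK⟩ := hA.exists_effective hmem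
  have hpath : ∀ v, Nonempty (A.APath v₀ v) := fun v =>
    (hA.connected v₀ v).elim GraphOfGroups.exists_apath
  let t : ∀ v, A.APath v₀ v :=
    Function.update (fun v => (hpath v).some) v₀ (GraphOfGroups.APath.nil 1)
  have ht : t v₀ = .nil 1 := Function.update_self ..
  let κ := Finite.equivFin ((V × Fin N) ⊕ GraphOfGroups.Edge V)
  have hgen := GraphOfGroups.generates_fundGen (K := K) (κ := κ) ht
  have := GroupAlgorithms.countable_of_generates hgen
  refine ⟨_, GraphOfGroups.fundGen K t κ, hgen, ?_⟩
  exact ComputablePred.computable_iff_re_compl_re'.2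
    ⟨GraphOfGroups.mem_re hK ht, GraphOfGroups.notMem_re hK hA.noetherian ht _⟩
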